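/- **Theorem (virtual periods of torus knots).** A *virtual knot diagram* is an oriented generic smooth immersion of a circle in the plane (only finitely many transverse double points), each double point being marked either as classical (with over/under information) or as virtual. Reading the classical crossings, with their signs and over/under information, along the curve gives its Gauss code, and a *virtual knot* is an equivalence class of Gauss codes (Gauss diagrams) under relabelling of crossings, change of base point and the Reidemeister moves. An integer $q\ge 1$ is a *(virtual) period* of a virtual knot $K$ if $K$ is represented by a virtual knot diagram that misses the origin and is invariant under the rotation of the plane by the angle $2\pi/q$ about the origin. Let $m,n\ge 2$ be relatively prime integers and let $K_{m,n}$ be the classical $(m,n)$-torus knot, regarded as a virtual knot. Let $p$ be a prime and $r\ge 1$. If $p^r$ is a virtual period of $K_{m,n}$, then $p\mid m$, or $p\mid n$, or $p=2$ and $r=1$. -/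

import Mathlib

open scoped ContDiff

/-! ### Gauss codes and virtual knots -/

/-- A letter of a Gauss code: the label of a crossing, whether the crossing is traversed along
its over-strand (`isOver = true`, written `O`) or its under-strand (`isOver = false`, written
`U`), and the sign of the crossing (`isPos = true` for a positive, i.e. right-handed, one). -/
structure GaussLetter where
  label : ℕ
  isOver : Bool
  isPos : Bool

namespace GaussLetter

/-- Rename the crossing. -/
def relabel (f : ℕ → ℕ) (x : GaussLetter) : GaussLetter := ⟨f x.label, x.isOver, x.isPos⟩

/-- The other passage through the same crossing. -/
def other (x : GaussLetter) : GaussLetter := ⟨x.label, !x.isOver, x.isPos⟩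

end GaussLetter

/-- A Gauss code: a word in which every crossing occurs exactly twice, once as an over-crossing
and once as an under-crossing, with the same sign.  (Read cyclically and up to renaming of the
crossings, it is the same thing as a Gauss diagram: the chord of a crossing goes from the letter
`O` to the letter `U`.) -/
structure GaussCode where
  word : List GaussLetter
  nodup : (word.map fun x => (x.label, x.isOver)).Nodup
  other_mem : ∀ x ∈ word, x.other ∈ word

namespace GaussCode

/-- The two-letter word `x y` or `y x`. -/
def pair (b : Bool) (x y : GaussLetter) : List GaussLetter := if b then [x, y] else [y, x]

/-- The elementary moves on Gauss codes: change of labels, change of base point and the oriented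
Reidemeister moves.

In the third Reidemeister move, a top, a middle and a bottom strand cross pairwise: top over
middle at `a`, top over bottom at `b`, middle over bottom at `c`, with arbitrary signs `ea`,
`eb`, `ec`.  For three lines in the plane in general position, with these crossing signs, there
is a `d = ±1` such that the top strand meets `a` before `b` iff `d * eb = 1`, the middle strand
meets `a` before `c` iff `d * ec = 1`, and the bottom strand meets `b` before `c` iff
`d * ea * eb * ec = 1`; moving one line across the crossing of the other two changes `d` to `-d`.
Signs are Booleans here and their product is `==`. -/
inductive Move : List GaussLetter → List GaussLetter → Prop
  | relabel (f : Equiv.Perm ℕ) (w : List GaussLetter) : Move w (w.map (GaussLetter.relabel f))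
  | rotate (u v : List GaussLetter) : Move (u ++ v) (v ++ u)
  | r1 (a : ℕ) (o e : Bool) (u : List GaussLetter) :
      Move ([⟨a, o, e⟩, ⟨a, !o, e⟩] ++ u) u
  | r2 (a b : ℕ) (s e : Bool) (u v : List GaussLetter) :
      Move ([⟨a, true, e⟩, ⟨b, true, !e⟩] ++ u ++ pair s ⟨a, false, e⟩ ⟨b, false, !e⟩ ++ v)
        (u ++ v)
  | r3_top_middle_bottom (a b c : ℕ) (ea eb ec d : Bool) (u v w : List GaussLetter) :
      Move
        (pair (d == eb) ⟨a, true, ea⟩ ⟨b, true, eb⟩ ++ u ++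
          pair (d == ec) ⟨a, false, ea⟩ ⟨c, true, ec⟩ ++ v ++
          pair (d == (ea == (eb == ec))) ⟨b, false, eb⟩ ⟨c, false, ec⟩ ++ w)
        (pair (!(d == eb)) ⟨a, true, ea⟩ ⟨b, true, eb⟩ ++ u ++
          pair (!(d == ec)) ⟨a, false, ea⟩ ⟨c, true, ec⟩ ++ v ++
          pair (!(d == (ea == (eb == ec)))) ⟨b, false, eb⟩ ⟨c, false, ec⟩ ++ w)
  | r3_top_bottom_middle (a b c : ℕ) (ea eb ec d : Bool) (u v w : List GaussLetter) :
      Move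
        (pair (d == eb) ⟨a, true, ea⟩ ⟨b, true, eb⟩ ++ u ++
          pair (d == (ea == (eb == ec))) ⟨b, false, eb⟩ ⟨c, false, ec⟩ ++ v ++
          pair (d == ec) ⟨a, false, ea⟩ ⟨c, true, ec⟩ ++ w)
        (pair (!(d == eb)) ⟨a, true, ea⟩ ⟨b, true, eb⟩ ++ u ++
          pair (!(d == (ea == (eb == ec)))) ⟨b, false, eb⟩ ⟨c, false, ec⟩ ++ v ++
          pair (!(d == ec)) ⟨a, false, ea⟩ ⟨c, true, ec⟩ ++ w)

/-- Virtual equivalence of Gauss codes: the equivalence relation generated by the moves. -/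
def virtualSetoid : Setoid GaussCode :=
  Relation.EqvGen.setoid fun C C' => Move C.word C'.word

end GaussCode

/-- A virtual knot: a Gauss code up to relabelling, change of base point and Reidemeister moves. -/
def VirtualKnot : Type := Quotient GaussCode.virtualSetoid

/-- The virtual knot represented by a Gauss code. -/
def GaussCode.knot (C : GaussCode) : VirtualKnot := Quotient.mk GaussCode.virtualSetoid C

/-! ### Virtual knot diagrams in the plane and periods -/

/-- The determinant of the pair of plane vectors `(z, w)`. -/
def planeDet (z w : ℂ) : ℝ := z.re * w.im - z.im * w.re

/-- An oriented virtual knot diagram: a smooth immersion of the circle `ℝ / ℤ` in the plane `ℂ`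
whose only multiple points are finitely many transverse double points, some of which are marked
as classical crossings, with over/under information.  The marked double points are recorded by
the Gauss code of the diagram together with the times in `[0, 1)` at which its letters are read;
all other double points are the virtual crossings. -/
structure VirtualKnotDiagram where
  curve : ℝ → ℂ
  smooth : ContDiff ℝ ∞ curve
  periodic : Function.Periodic curve 1
  immersion : ∀ t, deriv curve t ≠ 0
  finite_double :
    {s ∈ Set.Ico (0 : ℝ) 1 | ∃ t ∈ Set.Ico (0 : ℝ) 1, t ≠ s ∧ curve t = curve s}.Finite
  no_triple : ∀ s ∈ Set.Ico (0 : ℝ) 1, ∀ t ∈ Set.Ico (0 : ℝ) 1, ∀ u ∈ Set.Ico (0 : ℝ) 1,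
    curve s = curve t → curve t = curve u → s = t ∨ t = u ∨ s = u
  transverse : ∀ s ∈ Set.Ico (0 : ℝ) 1, ∀ t ∈ Set.Ico (0 : ℝ) 1,
    s ≠ t → curve s = curve t → planeDet (deriv curve s) (deriv curve t) ≠ 0
  code : GaussCode
  time : Fin code.word.length → ℝ
  time_mem : ∀ i, time i ∈ Set.Ico (0 : ℝ) 1
  time_strictMono : StrictMono time
  crossing : ∀ i j, (code.word.get i).label = (code.word.get j).label →
    curve (time i) = curve (time j)
  sign : ∀ i j, (code.word.get i).label = (code.word.get j).label →
    (code.word.get i).isOver = true → (code.word.get j).isOver = false →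
      ((code.word.get i).isPos = true ↔
        0 < planeDet (deriv curve (time i)) (deriv curve (time j)))

namespace VirtualKnotDiagram

/-- The virtual knot represented by a diagram. -/
def knot (D : VirtualKnotDiagram) : VirtualKnot := D.code.knot

/-- The diagram misses the origin and is invariant under the rotation by the angle `2π / q` about
the origin: the rotated curve is a reparametrization of the curve (by a diffeomorphism of the
circle `ℝ / ℤ`, given by a lift `φ` to `ℝ`), and classical crossings are taken to classical
crossings, over-strands to over-strands and under-strands to under-strands. -/
def IsPeriodic (D : VirtualKnotDiagram) (q : ℕ) : Prop :=
  (∀ t, D.curve t ≠ 0) ∧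
  ∃ φ : ℝ ≃ₜ ℝ, ContDiff ℝ ∞ φ ∧ ContDiff ℝ ∞ φ.symm ∧
    (∀ t, φ (t + 1) = φ t + 1 ∨ φ (t + 1) = φ t - 1) ∧
    (∀ t, D.curve (φ t) = Complex.exp (2 * Real.pi * Complex.I / q) * D.curve t) ∧
    ∀ i, ∃ j, ∃ k : ℤ, φ (D.time i) = D.time j + k ∧
      (D.code.word.get j).isOver = (D.code.word.get i).isOver

end VirtualKnotDiagram

/-- `q` is a (virtual) period of the virtual knot `K`: some virtual knot diagram of `K` misses
the origin and is invariant under the rotation by `2π / q` about the origin. -/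
def VirtualKnot.HasPeriod (K : VirtualKnot) (q : ℕ) : Prop :=
  ∃ D : VirtualKnotDiagram, D.knot = K ∧ D.IsPeriodic q

/-! ### Torus knots -/

/-- The letters read during the `s`-th passage through the braid `σ_{m-1} σ_{m-2} ⋯ σ_1` when one
follows the closure of the `m`-strand braid `(σ_{m-1} σ_{m-2} ⋯ σ_1) ^ n`.

Number the positions of the strands `0, …, m - 1` from left to right and the `n` copies of
`σ_{m-1} ⋯ σ_1` by `0, …, n - 1`.  In each copy the strand in position `m - 1` crosses over those
in positions `m - 2, …, 0`, in this order, and ends in position `0`, while the strand in a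
position `x < m - 1` crosses under it once and ends in position `x + 1`.  Hence, starting in
position `0` of copy `0`, the `s`-th passage goes through the copy `s % n`, starting in position
`s % m`.  The crossing under which the strand in position `x` of copy `j` passes is labelled by
the pair `(j, x)`; all crossings are positive. -/
def torusPassage (m n s : ℕ) : List GaussLetter :=
  if s % m = m - 1 then
    (List.range (m - 1)).reverse.map fun x => ⟨Nat.pair (s % n) x, true, true⟩
  else [⟨Nat.pair (s % n) (s % m), false, true⟩]

/-- The Gauss word of the closure of the braid `(σ_{m-1} ⋯ σ_1) ^ n`, for coprime `m` and `n`: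
the knot makes `m * n` passages. -/
def torusWord (m n : ℕ) : List GaussLetter := (List.range (m * n)).flatMap (torusPassage m n)

theorem mem_torusPassage {m n s : ℕ} {x : GaussLetter} :
    x ∈ torusPassage m n s ↔
      (s % m = m - 1 ∧ ∃ y < m - 1, x = ⟨Nat.pair (s % n) y, true, true⟩) ∨
      (s % m ≠ m - 1 ∧ x = ⟨Nat.pair (s % n) (s % m), false, true⟩) := by
  unfold torusPassage
  split_ifs with h
  · simp [h, eq_comm]
  · simp [h]

/-- The Gauss code of the torus knot `K_{m,n}`: the standard diagram of the (positive) torus knot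
as the closure of the `m`-strand braid `(σ_{m-1} ⋯ σ_1) ^ n`. -/
def torusCode (m n : ℕ) (h : m.Coprime n) : GaussCode where
  word := torusWord m n
  nodup := by
    rw [torusWord, List.map_flatMap, List.nodup_flatMap]
    constructor
    · intro s _
      unfold torusPassage
      split_ifs
      · rw [List.map_map]
        refine List.Nodup.map ?_ (List.nodup_reverse.2 List.nodup_range)
        intro x y hxy
        simpa using hxy
      · simp
    · refine List.Pairwise.imp_of_mem ?_ List.nodup_range
      intro s t hs ht hst
      rw [List.mem_range] at hs ht
      intro z hzs hzt
      rw [List.mem_map] at hzs hzt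
      obtain ⟨x, hx, rfl⟩ := hzs
      obtain ⟨y, hy, hxy⟩ := hzt
      apply hst
      have key : s % n = t % n ∧ s % m = t % m := by
        rw [mem_torusPassage] at hx hy
        rcases hx with ⟨h1, a, -, rfl⟩ | ⟨h1, rfl⟩ <;> rcases hy with ⟨h2, b, -, rfl⟩ | ⟨h2, rfl⟩
        all_goals simp_all
      have h3 : s ≡ t [MOD m * n] := (Nat.modEq_and_modEq_iff_modEq_mul h).1 ⟨key.2, key.1⟩
      exact Nat.ModEq.eq_of_lt_of_lt h3 hs ht
  other_mem := by
    intro x hx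
    rw [torusWord, List.mem_flatMap] at hx ⊢
    obtain ⟨s, hs, hx⟩ := hx
    rw [List.mem_range] at hs
    have hm : 0 < m := Nat.pos_of_ne_zero (by rintro rfl; simp at hs)
    have hn : 0 < n := Nat.pos_of_ne_zero (by rintro rfl; simp at hs)
    have crt : ∀ y < m, ∃ t ∈ List.range (m * n), t % m = y ∧ t % n = s % n := by
      intro y hy
      refine ⟨Nat.chineseRemainder h y (s % n), ?_, ?_, ?_⟩
      · exact List.mem_range.2 (Nat.chineseRemainder_lt_mul h _ _ hm.ne' hn.ne')
      · have := (Nat.chineseRemainder h y (s % n)).2.1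
        rwa [Nat.ModEq, Nat.mod_eq_of_lt hy] at this
      · have := (Nat.chineseRemainder h y (s % n)).2.2
        rwa [Nat.ModEq, Nat.mod_mod] at this
    rw [mem_torusPassage] at hx
    rcases hx with ⟨-, y, hy, rfl⟩ | ⟨h1, rfl⟩
    · obtain ⟨t, ht, ht1, ht2⟩ := crt y (by omega)
      refine ⟨t, ht, mem_torusPassage.2 (Or.inr ⟨by omega, ?_⟩)⟩
      simp [GaussLetter.other, ht1, ht2]
    · obtain ⟨t, ht, ht1, ht2⟩ := crt (m - 1) (by omega)
      refine ⟨t, ht, mem_torusPassage.2 (Or.inl ⟨ht1, s % m, ?_, ?_⟩)⟩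
      · have := Nat.mod_lt s hm
        omega
      · simp [GaussLetter.other, ht2]

/-- The torus knot `K_{m,n}`, as a virtual knot. -/
def torusKnot (m n : ℕ) (h : m.Coprime n) : VirtualKnot := (torusCode m n h).knot

/-! The invariant is the number of Alexander colourings over a commutative ring with a chosen unit;
it depends only on the virtual knot (`GaussCode.encard_colorings_eq`). Suppose that `p` divides
neither `m` nor `n` and that `q = p ^ r ≥ 3`. Let `k` be a finite field of characteristic `p` with a
primitive `mn`-th root of unity `η`, let `α = η ^ m * η ^ n`, and let `a` be the number of
colourings of the torus knot over `(k, α)`. These are compared with the colourings over the dual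
numbers `k[ε]` with the unit `τ = α + ε`.

The torus knot: a colouring is determined by two of its over-colours, and a non-constant one exists,
so `|k| < a ≤ |k| ^ 2`. The difference of the two over-colours is killed by `τ ^ (mn) - 1`. As `p ∤
mn`, `α` is a simple root of `T ^ (mn) - 1`, so a colouring over `k[ε]` has constant reduction
modulo `ε`. Hence there are at most `|k| * a` of them (`encard_colorings_torus_dual_le`).

The period: a rotation by `2π / q` induces a cyclic symmetry of order `q` of the Gauss code
(`VirtualKnotDiagram.IsPeriodic.exists_symmetry`). The translation `T` by it commutes with the
colouring equations, and `N = T - 1` is nilpotent since `q` is a power of `p`. The obstruction to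
lifting a colouring to `k[ε]` is a `T`-invariant vector, hence lies in the image of `N ^ (q - 1)`.
This power kills the cokernel of the equations, whose dimension is at most `2 ≤ q - 1`. So every
colouring lifts (`exists_lift_of_periodic`), and there are at least `a ^ 2` colourings over `k[ε]`.
Then `a ^ 2 ≤ |k| * a`, contradicting `|k| < a`. -/

/-! ### Alexander colourings of Gauss words -/

/-- The unit `t` or `t⁻¹`, according to a sign. -/
def signPow {X : Type*} [CommRing X] (t : Xˣ) (e : Bool) : Xˣ := if e then t else t⁻¹

/-- The operation of the Alexander quandle of `t` (`e = true`), or its inverse (`e = false`). -/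
def alexAct {X : Type*} [CommRing X] (t : Xˣ) (e : Bool) (x y : X) : X :=
  signPow t e * x + (1 - signPow t e) * y

/-- `Transport t c w x y`: a strand of colour `x` that reads the word `w` ends with the colour `y`,
where the over-strand of the crossing `a` has the colour `c a`. -/
def Transport {X : Type*} [CommRing X] (t : Xˣ) (c : ℕ → X) : List GaussLetter → X → X → Prop
  | [], x, y => x = y
  | l :: w, x, y => (l.isOver = true → x = c l.label) ∧
      Transport t c w (if l.isOver = true then x else alexAct t l.isPos x (c l.label)) y

/-- The Alexander colourings of a Gauss word: the colour of the base point and the colours of the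
over-strands. -/
def colorings {X : Type*} [CommRing X] (t : Xˣ) (w : List GaussLetter) : Set (X × (ℕ → X)) :=
  {z | Transport t z.2 w z.1 z.1 ∧ ∀ a, (∀ l ∈ w, l.label ≠ a) → z.2 a = 0}

section Transport

variable {X : Type*} [CommRing X] {t : Xˣ} {c c' : ℕ → X} {u v w : List GaussLetter} {x y z : X}

@[simp] theorem alexAct_self (e : Bool) (x : X) : alexAct t e x x = x := by
  simp only [alexAct]; ring

theorem signPow_mul_not (e : Bool) : (signPow t e : X) * signPow t (!e) = 1 := by
  cases e <;> simp [signPow]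

theorem alexAct_not (e : Bool) (x y : X) : alexAct t (!e) (alexAct t e x y) y = x := by
  have h := signPow_mul_not (t := t) e
  simp only [alexAct]
  linear_combination (x - y) * h

theorem alexAct_not' (e : Bool) (x y : X) : alexAct t e (alexAct t (!e) x y) y = x := by
  simpa using alexAct_not (t := t) (!e) x y

theorem alexAct_injective (e : Bool) (y : X) : Function.Injective fun x => alexAct t e x y :=
  Function.LeftInverse.injective (g := fun x => alexAct t (!e) x y) fun x => alexAct_not e x y

theorem alexAct_eq_right {e : Bool} (h : alexAct t e x y = y) : x = y :=
  alexAct_injective e y (by simpa using h)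

theorem alexAct_distrib (e e' : Bool) (x y z : X) :
    alexAct t e (alexAct t e' x y) z = alexAct t e' (alexAct t e x z) (alexAct t e y z) := by
  simp only [alexAct]; ring

@[simp] theorem transport_nil : Transport t c [] x y ↔ x = y := Iff.rfl

@[simp] theorem transport_cons {l : GaussLetter} :
    Transport t c (l :: w) x y ↔ (l.isOver = true → x = c l.label) ∧
      Transport t c w (if l.isOver = true then x else alexAct t l.isPos x (c l.label)) y := Iff.rfl

theorem transport_append :
    Transport t c (u ++ v) x y ↔ ∃ z, Transport t c u x z ∧ Transport t c v z y := by
  induction u generalizing x with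
  | nil => simp
  | cons l u ih => simp [ih, and_assoc]

theorem transport_congr (h : ∀ l ∈ w, c l.label = c' l.label) :
    Transport t c w x y ↔ Transport t c' w x y := by
  induction w generalizing x with
  | nil => simp
  | cons l w ih =>
    rw [transport_cons, transport_cons, ih fun l' hl' => h l' (by simp [hl']), h l (by simp)]

theorem transport_update {a : ℕ} {r : X} (h : ∀ l ∈ w, l.label ≠ a) :
    Transport t (Function.update c a r) w x y ↔ Transport t c w x y :=
  transport_congr fun l hl => by simp [h l hl]

theorem Transport.unique (h : Transport t c w x y) (h' : Transport t c w x z) : y = z := by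
  induction w generalizing x with
  | nil => exact h.symm.trans h'
  | cons l w ih => exact ih h.2 h'.2

theorem Transport.append_imp {u' v' : List GaussLetter}
    (hu : ∀ x y, Transport t c u x y → Transport t c' u' x y)
    (hv : ∀ x y, Transport t c v x y → Transport t c' v' x y) (x y : X)
    (h : Transport t c (u ++ v) x y) : Transport t c' (u' ++ v') x y := by
  obtain ⟨z, h1, h2⟩ := transport_append.1 h
  exact transport_append.2 ⟨z, hu _ _ h1, hv _ _ h2⟩

theorem transport_relabel (f : Equiv.Perm ℕ) :
    Transport t (c ∘ f.symm) (w.map (GaussLetter.relabel f)) x y ↔ Transport t c w x y := by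
  induction w generalizing x with
  | nil => simp
  | cons l w ih => simp [ih, GaussLetter.relabel]

end Transport

/-! ### Invariance of the number of colourings -/

/-- Every label occurs at most once as an over-crossing and at most once as an under-crossing. -/
def SimpleWord (w : List GaussLetter) : Prop := (w.map fun x => (x.label, x.isOver)).Nodup

section Moves

variable {X : Type*} [CommRing X] {t : Xˣ}

theorem mem_pair {b : Bool} {x y z : GaussLetter} :
    z ∈ GaussCode.pair b x y ↔ z = x ∨ z = y := by
  cases b <;> simp [GaussCode.pair, or_comm]

theorem SimpleWord.perm {w w' : List GaussLetter} (h : SimpleWord w) (p : w.Perm w') :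
    SimpleWord w' := (p.map _).nodup_iff.1 h

theorem pair_perm (b : Bool) (x y : GaussLetter) : (GaussCode.pair b x y).Perm [x, y] := by
  cases b
  · exact List.Perm.swap _ _ _
  · exact List.Perm.refl _

/-- In a simple word a label that occurs in an over- and in an under-letter does not occur in the
remainder. -/
theorem SimpleWord.label_ne {w u : List GaussLetter} {x y : GaussLetter} {a : ℕ}
    (h : SimpleWord w) (p : w.Perm (x :: y :: u)) (hx : x.label = a) (hy : y.label = a)
    (hxy : x.isOver = !y.isOver) : ∀ l ∈ u, l.label ≠ a := by
  intro l hl hla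
  have h' := h.perm p
  simp only [SimpleWord, List.map_cons, List.nodup_cons, List.mem_cons, List.mem_map, not_or,
    not_exists, not_and] at h'
  by_cases hlx : l.isOver = x.isOver
  · exact h'.1.2 l hl (by simp [hla, hx, hlx])
  · refine h'.2.1 l hl (by simp [hla, hy]; revert hlx hxy; cases l.isOver <;> cases x.isOver <;>
      cases y.isOver <;> simp)

theorem encard_colorings_relabel_le (f : Equiv.Perm ℕ) (w : List GaussLetter) :
    (colorings t w).encard ≤ (colorings t (w.map (GaussLetter.relabel f))).encard := by
  refine Set.encard_le_encard_of_injOn (f := fun z => (z.1, z.2 ∘ f.symm)) ?_ ?_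
  · rintro ⟨x, c⟩ ⟨h, h0⟩
    refine ⟨(transport_relabel f).2 h, fun a ha => h0 _ fun l hl hla => ?_⟩
    refine ha _ (List.mem_map_of_mem hl) ?_
    simp [GaussLetter.relabel, hla]
  · rintro ⟨x, c⟩ - ⟨x', c'⟩ - h
    simp only [Prod.mk.injEq] at h ⊢
    exact ⟨h.1, f.symm.surjective.injective_comp_right h.2⟩

theorem encard_colorings_relabel (f : Equiv.Perm ℕ) (w : List GaussLetter) :
    (colorings t (w.map (GaussLetter.relabel f))).encard = (colorings t w).encard := by
  refine le_antisymm ?_ (encard_colorings_relabel_le f w)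
  refine (encard_colorings_relabel_le f.symm _).trans_eq ?_
  have : GaussLetter.relabel f.symm ∘ GaussLetter.relabel f = id := by
    funext l; simp [GaussLetter.relabel]
  rw [List.map_map, this, List.map_id]

/-- The over-colours are kept and the base colour is replaced by the colour at the cut between `u`
and `v`. Since transport is deterministic, that colour recovers the old base colour. -/
theorem encard_colorings_rotate_le (u v : List GaussLetter) :
    (colorings t (u ++ v)).encard ≤ (colorings t (v ++ u)).encard := by
  have key : ∀ z ∈ colorings t (u ++ v), ∃ y, Transport t z.2 u z.1 y ∧ Transport t z.2 v y z.1 :=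
    fun z hz => transport_append.1 hz.1
  choose! g hg1 hg2 using key
  refine Set.encard_le_encard_of_injOn (f := fun z => (g z, z.2)) ?_ ?_
  · intro z hz
    refine ⟨transport_append.2 ⟨z.1, hg2 z hz, hg1 z hz⟩, fun a ha => hz.2 a fun l hl => ha l ?_⟩
    simpa [or_comm] using hl
  · rintro z hz z' hz' h
    simp only [Prod.mk.injEq] at h
    have h1 := hg2 z hz
    rw [h.1, h.2] at h1
    exact Prod.ext (h1.unique (hg2 z' hz')) h.2

theorem encard_colorings_r1 {a : ℕ} {o e : Bool} {u : List GaussLetter}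
    (h : SimpleWord ([⟨a, o, e⟩, ⟨a, !o, e⟩] ++ u)) :
    (colorings t ([⟨a, o, e⟩, ⟨a, !o, e⟩] ++ u)).encard = (colorings t u).encard := by
  have hu : ∀ l ∈ u, l.label ≠ a := h.label_ne (List.Perm.refl _) rfl rfl (by simp)
  have key : ∀ (x y : X) (c : ℕ → X), Transport t c ([⟨a, o, e⟩, ⟨a, !o, e⟩] ++ u) x y ↔
      x = c a ∧ Transport t c u x y := by
    intro x y c
    cases o
    · simp only [Bool.not_false, List.cons_append, List.nil_append, transport_cons,
        Bool.false_eq_true, false_implies, if_false, true_and, forall_const, if_true]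
      constructor
      · rintro ⟨h1, h2⟩
        have := alexAct_eq_right h1
        refine ⟨this, ?_⟩
        rwa [this, alexAct_self, ← this] at h2
      · rintro ⟨rfl, h2⟩
        simpa using h2
    · simp only [Bool.not_true, List.cons_append, List.nil_append, transport_cons,
        Bool.false_eq_true, false_implies, if_false, true_and, forall_const, if_true]
      constructor
      · rintro ⟨rfl, h2⟩
        simpa using h2
      · rintro ⟨rfl, h2⟩
        simpa using h2
  apply le_antisymm
  -- The label `a` disappears from the word, so its colour is reset to the default `0` that
  -- `colorings` demands. Nothing is lost, as the kink forces it to be the base colour.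
  · refine Set.encard_le_encard_of_injOn (f := fun z => (z.1, Function.update z.2 a 0)) ?_ ?_
    · rintro ⟨x, c⟩ ⟨h1, h2⟩
      refine ⟨(transport_update hu).2 ((key _ _ _).1 h1).2, fun b hb => ?_⟩
      rcases eq_or_ne b a with rfl | hba
      · simp
      · simpa [hba] using h2 b (by simpa [hba.symm] using hb)
    · rintro ⟨x, c⟩ ⟨h1, -⟩ ⟨x', c'⟩ ⟨h1', -⟩ hcc
      have e1 := ((key _ _ _).1 h1).1
      have e2 := ((key _ _ _).1 h1').1
      simp only [Prod.mk.injEq] at hcc e1 e2 ⊢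
      refine ⟨hcc.1, funext fun b => ?_⟩
      rcases eq_or_ne b a with rfl | hba
      · rw [← e1, ← e2, hcc.1]
      · simpa [hba] using congrFun hcc.2 b
  · refine Set.encard_le_encard_of_injOn (f := fun z => (z.1, Function.update z.2 a z.1)) ?_ ?_
    · rintro ⟨x, c⟩ ⟨h1, h2⟩
      refine ⟨(key _ _ _).2 ⟨by simp, (transport_update hu).2 h1⟩, fun b hb => ?_⟩
      have hba : b ≠ a := by
        rintro rfl
        exact hb ⟨b, o, e⟩ (by simp) rfl
      simpa [hba] using h2 b fun l hl => hb l (by simp [hl])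
    · rintro ⟨x, c⟩ ⟨-, h1⟩ ⟨x', c'⟩ ⟨-, h1'⟩ hcc
      simp only [Prod.mk.injEq] at hcc h1 h1' ⊢
      refine ⟨hcc.1, funext fun b => ?_⟩
      rcases eq_or_ne b a with rfl | hba
      · rw [h1 _ hu, h1' _ hu]
      · simpa [hba] using congrFun hcc.2 b

/-- Both over-colours equal the base colour, and the two under-passages act by it with opposite
signs, so they cancel in either order. -/
theorem encard_colorings_r2 {a b : ℕ} {s e : Bool} {u v : List GaussLetter}
    (h : SimpleWord ([⟨a, true, e⟩, ⟨b, true, !e⟩] ++ u ++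
      GaussCode.pair s ⟨a, false, e⟩ ⟨b, false, !e⟩ ++ v)) :
    (colorings t ([⟨a, true, e⟩, ⟨b, true, !e⟩] ++ u ++
      GaussCode.pair s ⟨a, false, e⟩ ⟨b, false, !e⟩ ++ v)).encard =
      (colorings t (u ++ v)).encard := by
  have hp : (([⟨a, true, e⟩, ⟨b, true, !e⟩] : List GaussLetter) ++ u ++
      GaussCode.pair s ⟨a, false, e⟩ ⟨b, false, !e⟩ ++ v).Perm
      ((⟨a, true, e⟩ : GaussLetter) :: ⟨a, false, e⟩ :: ⟨b, true, !e⟩ :: ⟨b, false, !e⟩ ::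
        (u ++ v)) := by
    have := pair_perm s ⟨a, false, e⟩ ⟨b, false, !e⟩
    rw [← Multiset.coe_eq_coe] at this ⊢
    simp only [← Multiset.coe_add, this, ← Multiset.cons_coe, ← Multiset.singleton_add,
      Multiset.coe_nil]
    abel
  have ha := h.label_ne hp rfl rfl (by simp)
  have hb : ∀ l ∈ u ++ v, l.label ≠ b := by
    intro l hl
    refine h.label_ne (x := ⟨b, true, !e⟩) (y := ⟨b, false, !e⟩)
      (u := ⟨a, true, e⟩ :: ⟨a, false, e⟩ :: (u ++ v)) (hp.trans ?_) rfl rfl (by simp) l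
      (by simp only [List.mem_cons]; exact .inr (.inr hl))
    simp only [← Multiset.coe_eq_coe, ← Multiset.cons_coe, ← Multiset.singleton_add]
    abel
  have hab : a ≠ b := by
    have := ha ⟨b, true, !e⟩ (by simp)
    exact fun h => this h.symm
  have ha : ∀ l ∈ u ++ v, l.label ≠ a := fun l hl =>
    ha l (by simp only [List.mem_cons]; exact .inr (.inr hl))
  have key : ∀ (x y : X) (c : ℕ → X), Transport t c ([⟨a, true, e⟩, ⟨b, true, !e⟩] ++ u ++
      GaussCode.pair s ⟨a, false, e⟩ ⟨b, false, !e⟩ ++ v) x y ↔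
      x = c a ∧ x = c b ∧ Transport t c (u ++ v) x y := by
    intro x y c
    have h2 : x = c a → x = c b → ∀ z z', Transport t c
        (GaussCode.pair s ⟨a, false, e⟩ ⟨b, false, !e⟩) z z' ↔ z = z' := by
      intro e1 e2 z z'
      cases s
      · simp [GaussCode.pair, ← e1, ← e2, alexAct_not']
      · simp [GaussCode.pair, ← e1, ← e2, alexAct_not]
    simp only [List.append_assoc, List.cons_append, List.nil_append, transport_cons,
      forall_const, if_true]
    refine and_congr_right fun e1 => and_congr_right fun e2 => ?_
    simp only [transport_append, h2 e1 e2, exists_eq_left']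
  have hsupp : ∀ b' : ℕ, b' ≠ a → b' ≠ b → (∀ l ∈ u ++ v, l.label ≠ b') →
      ∀ l ∈ ([⟨a, true, e⟩, ⟨b, true, !e⟩] : List GaussLetter) ++ u ++
      GaussCode.pair s ⟨a, false, e⟩ ⟨b, false, !e⟩ ++ v, l.label ≠ b' := by
    intro b' h1 h2 h3 l hl
    rw [hp.mem_iff] at hl
    simp only [List.mem_cons] at hl
    rcases hl with rfl | rfl | rfl | rfl | hl
    · exact h1.symm
    · exact h1.symm
    · exact h2.symm
    · exact h2.symm
    · exact h3 l hl
  apply le_antisymm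
  · refine Set.encard_le_encard_of_injOn
      (f := fun z => (z.1, Function.update (Function.update z.2 a 0) b 0)) ?_ ?_
    · rintro ⟨x, c⟩ ⟨h1, h2⟩
      refine ⟨(transport_update hb).2 ((transport_update ha).2 ((key _ _ _).1 h1).2.2),
        fun b' hb' => ?_⟩
      rcases eq_or_ne b' b with rfl | hbb
      · simp
      rcases eq_or_ne b' a with rfl | hba
      · simp [hbb]
      simpa [hba, hbb] using h2 b' (hsupp b' hba hbb hb')
    · rintro ⟨x, c⟩ ⟨h1, -⟩ ⟨x', c'⟩ ⟨h1', -⟩ hcc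
      obtain ⟨e1, e2, -⟩ := (key _ _ _).1 h1
      obtain ⟨e1', e2', -⟩ := (key _ _ _).1 h1'
      simp only [Prod.mk.injEq] at hcc e1 e2 e1' e2' ⊢
      refine ⟨hcc.1, funext fun b' => ?_⟩
      rcases eq_or_ne b' b with rfl | hbb
      · rw [← e2, ← e2', hcc.1]
      rcases eq_or_ne b' a with rfl | hba
      · rw [← e1, ← e1', hcc.1]
      simpa [hba, hbb] using congrFun hcc.2 b'
  · refine Set.encard_le_encard_of_injOn
      (f := fun z => (z.1, Function.update (Function.update z.2 a z.1) b z.1)) ?_ ?_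
    · rintro ⟨x, c⟩ ⟨h1, h2⟩
      refine ⟨(key _ _ _).2 ⟨by simp [hab], by simp, (transport_update hb).2
        ((transport_update ha).2 h1)⟩, fun b' hb' => ?_⟩
      have hba : b' ≠ a := by
        rintro rfl
        exact hb' ⟨b', true, e⟩ (by simp) rfl
      have hbb : b' ≠ b := by
        rintro rfl
        exact hb' ⟨b', true, !e⟩ (by simp) rfl
      simpa [hba, hbb] using h2 b' fun l hl => hb' l (hp.mem_iff.2 (by
        simp only [List.mem_cons]; exact .inr (.inr (.inr (.inr hl)))))
    · rintro ⟨x, c⟩ ⟨-, h1⟩ ⟨x', c'⟩ ⟨-, h1'⟩ hcc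
      simp only [Prod.mk.injEq] at hcc h1 h1' ⊢
      refine ⟨hcc.1, funext fun b' => ?_⟩
      rcases eq_or_ne b' b with rfl | hbb
      · rw [h1 _ hb, h1' _ hb]
      rcases eq_or_ne b' a with rfl | hba
      · rw [h1 _ ha, h1' _ ha]
      simpa [hba, hbb] using congrFun hcc.2 b'

end Moves

/-! ### The third Reidemeister move. -/

section ThirdMove

variable {X : Type*} [CommRing X] {t : Xˣ}

/-- The change of over-colours under a third Reidemeister move: the colour of the middle strand at
its crossing over the bottom strand is acted upon by the top strand. -/
def r3Colors (t : Xˣ) (a m : ℕ) (e : Bool) (c : ℕ → X) : ℕ → X :=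
  Function.update c m (alexAct t e (c m) (c a))

theorem r3Colors_injective {a m : ℕ} (ham : a ≠ m) (e : Bool) :
    Function.Injective (r3Colors t a m e) := by
  intro c c' h
  have ha : c a = c' a := by simpa [r3Colors, ham] using congrFun h a
  funext b
  rcases eq_or_ne b m with rfl | hb
  · have := congrFun h b
    simp only [r3Colors, Function.update_self, ha] at this
    exact alexAct_injective _ _ this
  · simpa [r3Colors, hb] using congrFun h b

theorem transport_top {c : ℕ → X} {a b : ℕ} {i ea eb : Bool} {x y : X} :
    Transport t c (GaussCode.pair i ⟨a, true, ea⟩ ⟨b, true, eb⟩) x y ↔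
      x = c a ∧ x = c b ∧ x = y := by
  cases i
  · simp [GaussCode.pair, and_left_comm]
  · simp [GaussCode.pair]

theorem transport_middle {c : ℕ → X} {a m : ℕ} (ham : a ≠ m) {i ea em : Bool} (x y : X)
    (h : Transport t c (GaussCode.pair i ⟨a, false, ea⟩ ⟨m, true, em⟩) x y) :
    Transport t (r3Colors t a m (ea == !i) c)
      (GaussCode.pair (!i) ⟨a, false, ea⟩ ⟨m, true, em⟩) x y := by
  cases i
  · simp [GaussCode.pair, r3Colors, ham] at h ⊢
    rcases h with ⟨rfl, rfl⟩
    simp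
  · simp [GaussCode.pair, r3Colors, ham] at h ⊢
    rcases h with ⟨h, rfl⟩
    rw [← h]
    simp [alexAct_not]

/-- This is self-distributivity of the quandle: acting by the middle and then the top strand agrees
with acting by the top strand and then by the middle strand as moved by the top one. The two top
crossings carry one colour, by `hc`. -/
theorem transport_bottom {c : ℕ → X} {a b m : ℕ} (hbm : b ≠ m) (hc : c a = c b)
    {i ea eb em : Bool} (x y : X)
    (h : Transport t c (GaussCode.pair (i == (ea == eb)) ⟨b, false, eb⟩ ⟨m, false, em⟩) x y) :
    Transport t (r3Colors t a m (ea == !i) c)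
      (GaussCode.pair (!(i == (ea == eb))) ⟨b, false, eb⟩ ⟨m, false, em⟩) x y := by
  cases i <;> cases ea <;> cases eb <;>
  · simp [GaussCode.pair, r3Colors, hbm, ← hc] at h ⊢
    subst h
    first
    | exact (alexAct_distrib _ _ _ _ _).symm
    | rw [alexAct_distrib]
      first
      | exact congrArg _ (alexAct_not true _ _)
      | exact congrArg _ (alexAct_not false _ _)

theorem r3_perm {i j k : Bool} {a a' b b' m m' : GaussLetter} {u v w : List GaussLetter} :
    (GaussCode.pair i a b ++ u ++ GaussCode.pair j a' m ++ v ++ GaussCode.pair k b' m' ++ w).Perm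
      (a :: a' :: b :: b' :: m :: m' :: (u ++ v ++ w)) := by
  have h1 := pair_perm i a b
  have h2 := pair_perm j a' m
  have h3 := pair_perm k b' m'
  rw [← Multiset.coe_eq_coe] at h1 h2 h3 ⊢
  simp only [← Multiset.coe_add, h1, h2, h3, ← Multiset.cons_coe, ← Multiset.singleton_add,
    Multiset.coe_nil]
  abel

theorem r3_labels {w' : List GaussLetter} {a b m : ℕ} {ea eb em : Bool} {u : List GaussLetter}
    (h : SimpleWord w') (p : w'.Perm ((⟨a, true, ea⟩ : GaussLetter) :: ⟨a, false, ea⟩ ::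
      ⟨b, true, eb⟩ :: ⟨b, false, eb⟩ :: ⟨m, true, em⟩ :: ⟨m, false, em⟩ :: u)) :
    a ≠ m ∧ b ≠ m ∧ ∀ l ∈ u, l.label ≠ m := by
  have key : ∀ l ∈ (⟨a, true, ea⟩ : GaussLetter) :: ⟨a, false, ea⟩ ::
      ⟨b, true, eb⟩ :: ⟨b, false, eb⟩ :: u, l.label ≠ m := by
    refine h.label_ne (x := ⟨m, true, em⟩) (y := ⟨m, false, em⟩) (p.trans ?_) rfl rfl (by simp)
    simp only [← Multiset.coe_eq_coe, ← Multiset.cons_coe, ← Multiset.singleton_add]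
    abel
  simp only [List.mem_cons, forall_eq_or_imp] at key
  exact ⟨key.1, key.2.2.1, key.2.2.2.2⟩

theorem r3_support {i j k : Bool} {a a' b b' m m' : GaussLetter} {u v w : List GaussLetter}
    {n : ℕ} :
    (∀ l ∈ GaussCode.pair (!i) a b ++ u ++ GaussCode.pair (!j) a' m ++ v ++
        GaussCode.pair (!k) b' m' ++ w, l.label ≠ n) ↔
      ∀ l ∈ GaussCode.pair i a b ++ u ++ GaussCode.pair j a' m ++ v ++
        GaussCode.pair k b' m' ++ w, l.label ≠ n := by
  simp only [r3_perm.mem_iff]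

theorem r3_support' {i j k : Bool} {a a' b b' m m' : GaussLetter} {u v w : List GaussLetter}
    {n : ℕ} :
    (∀ l ∈ GaussCode.pair (!i) a b ++ u ++ GaussCode.pair (!k) b' m' ++ v ++
        GaussCode.pair (!j) a' m ++ w, l.label ≠ n) ↔
      ∀ l ∈ GaussCode.pair i a b ++ u ++ GaussCode.pair k b' m' ++ v ++
        GaussCode.pair j a' m ++ w, l.label ≠ n := by
  simp only [List.mem_append, mem_pair]

/-- Expresses the order on the bottom strand through the order `d == em` on the middle strand, which
is the form that `transport_bottom` takes. -/
theorem bool_beq_assoc (d ea eb em : Bool) :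
    (d == (ea == (eb == em))) = ((d == em) == (ea == eb)) := by
  cases d <;> cases ea <;> cases eb <;> cases em <;> rfl

/-- Only the over-colour at `m` changes, and the rest of the word does not read it, so the three
crossing pairs can be treated separately. An inequality is enough, because the inverse move is the
same move with `!d` for `d`. -/
theorem encard_colorings_r3_tmb_le (a b m : ℕ) (ea eb em d : Bool) (u v w : List GaussLetter)
    (h : SimpleWord (GaussCode.pair (d == eb) ⟨a, true, ea⟩ ⟨b, true, eb⟩ ++ u ++
          GaussCode.pair (d == em) ⟨a, false, ea⟩ ⟨m, true, em⟩ ++ v ++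
          GaussCode.pair (d == (ea == (eb == em))) ⟨b, false, eb⟩ ⟨m, false, em⟩ ++ w)) :
    (colorings t (GaussCode.pair (d == eb) ⟨a, true, ea⟩ ⟨b, true, eb⟩ ++ u ++
          GaussCode.pair (d == em) ⟨a, false, ea⟩ ⟨m, true, em⟩ ++ v ++
          GaussCode.pair (d == (ea == (eb == em))) ⟨b, false, eb⟩ ⟨m, false, em⟩ ++ w)).encard ≤
      (colorings t (GaussCode.pair (!(d == eb)) ⟨a, true, ea⟩ ⟨b, true, eb⟩ ++ u ++
          GaussCode.pair (!(d == em)) ⟨a, false, ea⟩ ⟨m, true, em⟩ ++ v ++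
          GaussCode.pair (!(d == (ea == (eb == em)))) ⟨b, false, eb⟩ ⟨m, false, em⟩ ++
          w)).encard := by
  obtain ⟨ham, hbm, hm⟩ := r3_labels h r3_perm
  rw [bool_beq_assoc] at h ⊢
  set i := (d == em)
  have hseg : ∀ s : List GaussLetter, (∀ l ∈ s, l ∈ u ++ v ++ w) → ∀ (c : ℕ → X) (x y : X),
      Transport t c s x y → Transport t (r3Colors t a m (ea == !i) c) s x y :=
    fun s hs c x y hT => (transport_update fun l hl => hm l (hs l hl)).2 hT
  refine Set.encard_le_encard_of_injOn (f := fun z => (z.1, r3Colors t a m (ea == !i) z.2)) ?_ ?_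
  · rintro ⟨x, c⟩ ⟨h1, h2⟩
    have hc : c a = c b := by
      simp only [List.append_assoc] at h1
      obtain ⟨z, hz, -⟩ := transport_append.1 h1
      obtain ⟨e1, e2, -⟩ := transport_top.1 hz
      exact e1.symm.trans e2
    refine ⟨?_, fun n hn => ?_⟩
    · refine Transport.append_imp (Transport.append_imp (Transport.append_imp
        (Transport.append_imp (Transport.append_imp ?_ ?_) ?_) ?_) ?_) ?_ _ _ h1
      · intro x y hT
        rw [transport_top] at hT ⊢
        simpa [r3Colors, ham, hbm] using hT
      · exact hseg u (by simp +contextual) c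
      · exact transport_middle ham
      · exact hseg v (by simp +contextual) c
      · exact transport_bottom hbm hc
      · exact hseg w (by simp +contextual) c
    · have hn' := r3_support.1 hn
      have hnm : n ≠ m := by
        rintro rfl
        exact hn' ⟨n, true, em⟩ (by simp [mem_pair]) rfl
      simpa [r3Colors, hnm] using h2 n hn'
  · rintro ⟨x, c⟩ - ⟨x', c'⟩ - hcc
    simp only [Prod.mk.injEq] at hcc ⊢
    exact ⟨hcc.1, r3Colors_injective ham _ hcc.2⟩

theorem encard_colorings_r3_tbm_le (a b m : ℕ) (ea eb em d : Bool) (u v w : List GaussLetter)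
    (h : SimpleWord (GaussCode.pair (d == eb) ⟨a, true, ea⟩ ⟨b, true, eb⟩ ++ u ++
          GaussCode.pair (d == (ea == (eb == em))) ⟨b, false, eb⟩ ⟨m, false, em⟩ ++ v ++
          GaussCode.pair (d == em) ⟨a, false, ea⟩ ⟨m, true, em⟩ ++ w)) :
    (colorings t (GaussCode.pair (d == eb) ⟨a, true, ea⟩ ⟨b, true, eb⟩ ++ u ++
          GaussCode.pair (d == (ea == (eb == em))) ⟨b, false, eb⟩ ⟨m, false, em⟩ ++ v ++
          GaussCode.pair (d == em) ⟨a, false, ea⟩ ⟨m, true, em⟩ ++ w)).encard ≤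
      (colorings t (GaussCode.pair (!(d == eb)) ⟨a, true, ea⟩ ⟨b, true, eb⟩ ++ u ++
          GaussCode.pair (!(d == (ea == (eb == em)))) ⟨b, false, eb⟩ ⟨m, false, em⟩ ++ v ++
          GaussCode.pair (!(d == em)) ⟨a, false, ea⟩ ⟨m, true, em⟩ ++
          w)).encard := by
  have hp : (GaussCode.pair (d == eb) (⟨a, true, ea⟩ : GaussLetter) ⟨b, true, eb⟩ ++ u ++
          GaussCode.pair (d == (ea == (eb == em))) ⟨b, false, eb⟩ ⟨m, false, em⟩ ++ v ++
          GaussCode.pair (d == em) ⟨a, false, ea⟩ ⟨m, true, em⟩ ++ w).Perm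
      (GaussCode.pair (d == eb) ⟨a, true, ea⟩ ⟨b, true, eb⟩ ++ u ++
          GaussCode.pair (d == em) ⟨a, false, ea⟩ ⟨m, true, em⟩ ++ v ++
          GaussCode.pair (d == (ea == (eb == em))) ⟨b, false, eb⟩ ⟨m, false, em⟩ ++ w) := by
    simp only [← Multiset.coe_eq_coe, ← Multiset.coe_add]
    abel
  obtain ⟨ham, hbm, hm⟩ := r3_labels h (hp.trans r3_perm)
  rw [bool_beq_assoc] at h ⊢
  set i := (d == em)
  have hseg : ∀ s : List GaussLetter, (∀ l ∈ s, l ∈ u ++ v ++ w) → ∀ (c : ℕ → X) (x y : X),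
      Transport t c s x y → Transport t (r3Colors t a m (ea == !i) c) s x y :=
    fun s hs c x y hT => (transport_update fun l hl => hm l (hs l hl)).2 hT
  refine Set.encard_le_encard_of_injOn (f := fun z => (z.1, r3Colors t a m (ea == !i) z.2)) ?_ ?_
  · rintro ⟨x, c⟩ ⟨h1, h2⟩
    have hc : c a = c b := by
      simp only [List.append_assoc] at h1
      obtain ⟨z, hz, -⟩ := transport_append.1 h1
      obtain ⟨e1, e2, -⟩ := transport_top.1 hz
      exact e1.symm.trans e2
    refine ⟨?_, fun n hn => ?_⟩
    · refine Transport.append_imp (Transport.append_imp (Transport.append_imp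
        (Transport.append_imp (Transport.append_imp ?_ ?_) ?_) ?_) ?_) ?_ _ _ h1
      · intro x y hT
        rw [transport_top] at hT ⊢
        simpa [r3Colors, ham, hbm] using hT
      · exact hseg u (by simp +contextual) c
      · exact transport_bottom hbm hc
      · exact hseg v (by simp +contextual) c
      · exact transport_middle ham
      · exact hseg w (by simp +contextual) c
    · have hn' := r3_support'.1 hn
      have hnm : n ≠ m := by
        rintro rfl
        exact hn' ⟨n, true, em⟩ (by simp [mem_pair]) rfl
      simpa [r3Colors, hnm] using h2 n hn'
  · rintro ⟨x, c⟩ - ⟨x', c'⟩ - hcc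
    simp only [Prod.mk.injEq] at hcc ⊢
    exact ⟨hcc.1, r3Colors_injective ham _ hcc.2⟩

theorem not_beq_eq (d e : Bool) : (!(d == e)) = ((!d) == e) := by cases d <;> cases e <;> rfl

/-- The number of Alexander colourings is invariant under the elementary moves. -/
theorem GaussCode.Move.encard_colorings {w w' : List GaussLetter} (h : GaussCode.Move w w')
    (hw : SimpleWord w) (hw' : SimpleWord w') :
    (colorings t w).encard = (colorings t w').encard := by
  cases h with
  | relabel f w => exact (encard_colorings_relabel f w).symm
  | rotate u v => exact le_antisymm (encard_colorings_rotate_le u v) (encard_colorings_rotate_le v u)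
  | r1 a o e u => exact encard_colorings_r1 hw
  | r2 a b s e u v => exact encard_colorings_r2 hw
  | r3_top_middle_bottom a b c ea eb ec d u v w =>
    -- For the reverse inequality the negations are absorbed into `d`, and the same lemma is applied
    -- with `!d`.
    refine le_antisymm (encard_colorings_r3_tmb_le _ _ _ _ _ _ _ _ _ _ hw) ?_
    simp only [not_beq_eq] at hw' ⊢
    refine (encard_colorings_r3_tmb_le _ _ _ _ _ _ _ _ _ _ hw').trans_eq ?_
    simp only [not_beq_eq, Bool.not_not]
  | r3_top_bottom_middle a b c ea eb ec d u v w =>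
    refine le_antisymm (encard_colorings_r3_tbm_le _ _ _ _ _ _ _ _ _ _ hw) ?_
    simp only [not_beq_eq] at hw' ⊢
    refine (encard_colorings_r3_tbm_le _ _ _ _ _ _ _ _ _ _ hw').trans_eq ?_
    simp only [not_beq_eq, Bool.not_not]

/-- The number of Alexander colourings is an invariant of virtual knots. -/
theorem GaussCode.encard_colorings_eq {C C' : GaussCode} (h : C.knot = C'.knot) :
    (colorings t C.word).encard = (colorings t C'.word).encard := by
  have h' : Relation.EqvGen (fun C C' : GaussCode => GaussCode.Move C.word C'.word) C C' :=
    Quotient.exact h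
  induction h' with
  | rel C C' hm => exact hm.encard_colorings C.nodup C'.nodup
  | refl => rfl
  | symm C C' _ ih => exact (ih (Quotient.sound ‹_›)).symm
  | trans C C' C'' _ _ ih1 ih2 =>
    exact (ih1 (Quotient.sound ‹_›)).trans (ih2 (Quotient.sound ‹_›))

end ThirdMove

/-! ### Colourings of periodic cyclic words -/

section SemiarcMap

variable {X Y : Type*} [CommRing X] [CommRing Y] {L : ℕ}

/-- The equations of the Alexander colourings of a cyclic word of length `L`, for colours of the
semi-arcs: the letter `i` is an over-letter iff `ov i`, has the sign `sg i`, and the other letter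
of its crossing is `prt i`. -/
def semiarcMap (t : Xˣ) (ov sg : ZMod L → Bool) (prt : ZMod L → ZMod L) :
    (ZMod L → X) →ₗ[X] (ZMod L → X) where
  toFun f i := f (i + 1) - if ov i = true then f i else alexAct t (sg i) (f i) (f (prt i))
  map_add' f g := by
    funext i
    by_cases h : ov i = true <;> simp [h, alexAct] <;> ring
  map_smul' a f := by
    funext i
    by_cases h : ov i = true <;> simp [h, alexAct] <;> ring

variable {t : Xˣ} {ov sg : ZMod L → Bool} {prt : ZMod L → ZMod L}

theorem semiarcMap_apply (f : ZMod L → X) (i : ZMod L) : semiarcMap t ov sg prt f i =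
    f (i + 1) - if ov i = true then f i else alexAct t (sg i) (f i) (f (prt i)) := rfl

theorem semiarcMap_const (x : X) : semiarcMap t ov sg prt (fun _ => x) = 0 := by
  funext i
  simp [semiarcMap_apply]

theorem map_signPow (ρ : X →+* Y) (e : Bool) :
    ρ (signPow t e : X) = (signPow (Units.map (ρ : X →* Y) t) e : Yˣ) := by
  cases e <;> simp [signPow, ← map_inv]

theorem map_alexAct (ρ : X →+* Y) (e : Bool) (x y : X) :
    ρ (alexAct t e x y) = alexAct (Units.map (ρ : X →* Y) t) e (ρ x) (ρ y) := by
  simp [alexAct, map_signPow]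

theorem map_semiarcMap (ρ : X →+* Y) (f : ZMod L → X) (i : ZMod L) :
    ρ (semiarcMap t ov sg prt f i) =
      semiarcMap (Units.map (ρ : X →* Y) t) ov sg prt (ρ ∘ f) i := by
  by_cases h : ov i = true <;> simp [semiarcMap_apply, h, map_alexAct]

theorem semiarcMap_translate {c : ZMod L} (hov : ∀ i, ov (i + c) = ov i)
    (hsg : ∀ i, sg (i + c) = sg i) (hprt : ∀ i, prt (i + c) = prt i + c) (f : ZMod L → X)
    (i : ZMod L) :
    semiarcMap t ov sg prt (fun j => f (j + c)) i = semiarcMap t ov sg prt f (i + c) := by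
  simp only [semiarcMap_apply, hov, hsg, hprt, add_right_comm]

end SemiarcMap

/-! ### Nilpotent endomorphisms and translations in characteristic `p`. -/

section Nilpotent

variable {k V : Type*} [Field k] [AddCommGroup V] [Module k V] [FiniteDimensional k V]

/-- `N` induces a nilpotent endomorphism of `V ⧸ W`, and a nilpotent endomorphism of a space of
dimension at most `d` has vanishing `d`-th power. -/
theorem Module.End.pow_apply_mem_of_isNilpotent {N : Module.End k V} (hN : IsNilpotent N)
    {W : Submodule k V} (hW : W ≤ W.comap N) {d : ℕ} (hd : Module.finrank k (V ⧸ W) ≤ d) (v : V) :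
    (N ^ d) v ∈ W := by
  have hcomm : ∀ j : ℕ, ∀ v, ((W.mapQ W N hW) ^ j) (W.mkQ v) = W.mkQ ((N ^ j) v) := by
    intro j
    induction j with
    | zero => simp
    | succ j ih =>
      intro v
      rw [pow_succ, pow_succ, Module.End.mul_apply, Module.End.mul_apply, ← ih]
      simp
  obtain ⟨n, hn⟩ := hN
  have h1 : LinearMap.ker ((W.mapQ W N hW) ^ (max n d)) = ⊤ := by
    rw [LinearMap.ker_eq_top]
    refine pow_eq_zero_of_le (le_max_left n d) (LinearMap.ext fun x => ?_)
    obtain ⟨v, rfl⟩ := W.mkQ_surjective x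
    rw [hcomm, hn]
    simp
  rw [Module.End.ker_pow_eq_ker_pow_finrank_of_le (hd.trans (le_max_right n d)),
    ← Module.End.ker_pow_eq_ker_pow_finrank_of_le hd, LinearMap.ker_eq_top] at h1
  have := hcomm d v
  rw [h1] at this
  simpa using this.symm

end Nilpotent

section Periodic

variable {k : Type*} [Field k] {p : ℕ} [Fact p.Prime] [CharP k p]

open Polynomial in
-- Divide `(X - 1) ^ (p ^ r) = X ^ (p ^ r) - 1` by `X - 1`. At a translation, the right side becomes
-- the norm of the cyclic group it generates.
theorem Polynomial.X_sub_one_pow_pred_char_pow (r : ℕ) :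
    (X - 1 : k[X]) ^ (p ^ r - 1) = ∑ i ∈ Finset.range (p ^ r), X ^ i := by
  have hX : (X - 1 : k[X]) ≠ 0 := X_sub_C_ne_zero (1 : k)
  apply mul_right_cancel₀ hX
  rw [geom_sum_mul, ← pow_succ, Nat.sub_add_cancel (Nat.one_le_pow _ _ (Fact.out : p.Prime).pos),
    sub_pow_char_pow, one_pow]

variable {L : ℕ}

/-- The translation of functions on `ZMod L` by `c`. -/
def funTranslate (k : Type*) [Field k] (c : ZMod L) : Module.End k (ZMod L → k) :=
  LinearMap.funLeft k k (· + c)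

theorem translate_pow_apply (c : ZMod L) (j : ℕ) (f : ZMod L → k) (i : ZMod L) :
    ((funTranslate k c) ^ j) f i = f (i + j • c) := by
  induction j generalizing i with
  | zero => simp
  | succ j ih =>
    rw [pow_succ', Module.End.mul_apply]
    change ((funTranslate k c) ^ j) f (i + c) = _
    rw [ih, succ_nsmul', add_assoc]

theorem translate_sub_one_pow (c : ZMod L) (r : ℕ) (hc : p ^ r • c = 0) :
    (funTranslate k c - 1) ^ (p ^ r) = 0 := by
  have h := congrArg (Polynomial.aeval (funTranslate k c))
    (sub_pow_char_pow (p := p) (n := r) (Polynomial.X : Polynomial k) 1)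
  simp only [map_pow, map_sub, Polynomial.aeval_X, map_one, one_pow] at h
  rw [h, sub_eq_zero]
  refine LinearMap.ext fun f => funext fun i => ?_
  rw [translate_pow_apply, hc]
  simp

variable {ov sg : ZMod L → Bool} {prt : ZMod L → ZMod L}

theorem dualNumber_mul_inr (x : DualNumber k) (a : k) :
    x * TrivSqZeroExt.inr a = TrivSqZeroExt.inr (x.fst * a) := by
  ext <;> simp [mul_comm]

theorem semiarcMap_inr {α : kˣ} {τ : (DualNumber k)ˣ}
    (hτ : Units.map (TrivSqZeroExt.fstHom k k k : DualNumber k →+* k) τ = α) (v : ZMod L → k) :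
    semiarcMap τ ov sg prt (fun i => TrivSqZeroExt.inr (v i)) =
      fun i => TrivSqZeroExt.inr (semiarcMap α ov sg prt v i) := by
  have h : ∀ e, (signPow τ e : DualNumber k).fst = signPow α e := by
    intro e
    rw [← hτ, ← map_signPow]
    rfl
  funext i
  by_cases hi : ov i = true
  · simp only [semiarcMap_apply, hi, if_true, ← TrivSqZeroExt.inr_sub]
  · simp only [semiarcMap_apply, hi, Bool.false_eq_true, if_false, alexAct, dualNumber_mul_inr, TrivSqZeroExt.fst_sub,
      TrivSqZeroExt.fst_one, h, ← TrivSqZeroExt.inr_sub, ← TrivSqZeroExt.inr_add]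

variable [NeZero L]

/-- A function that is invariant under the translation by an element of order `p ^ r` is a norm. -/
theorem exists_translate_sub_one_pow_pred (c : ZMod L) (r : ℕ) (hc : addOrderOf c = p ^ r)
    (w : ZMod L → k) (hw : ∀ i, w (i + c) = w i) :
    ∃ w₀, w = ((funTranslate k c - 1) ^ (p ^ r - 1)) w₀ := by
  classical
  let H := AddSubgroup.zmultiples c
  let rep : ZMod L → ZMod L := fun i => (QuotientAddGroup.mk i : ZMod L ⧸ H).out
  have hrep : ∀ i, ∃ j < p ^ r, i + j • c = rep i := by
    intro i
    have h : -i + rep i ∈ H := QuotientAddGroup.eq.1 (Quotient.out_eq _).symm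
    rw [mem_zmultiples_iff_mem_range_addOrderOf, hc] at h
    obtain ⟨j, hj, hj'⟩ := Finset.mem_image.1 h
    exact ⟨j, Finset.mem_range.1 hj, by rw [hj']; abel⟩
  have hrepc : ∀ i (j : ℕ), rep (i + j • c) = rep i := by
    intro i j
    have : (QuotientAddGroup.mk (i + j • c) : ZMod L ⧸ H) = QuotientAddGroup.mk i := by
      rw [eq_comm, QuotientAddGroup.eq]
      simpa using H.nsmul_mem (AddSubgroup.mem_zmultiples c) j
    simp only [rep, this]
  have hwc : ∀ i (j : ℕ), w (i + j • c) = w i := by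
    intro i j
    induction j with
    | zero => simp
    | succ j ih => rw [succ_nsmul, ← add_assoc, hw, ih]
  -- The preimage is `w` supported on one representative of each orbit; summing over the translates
  -- meets that representative exactly once.
  refine ⟨fun i => if i = rep i then w i else 0, ?_⟩
  have h := congrArg (Polynomial.aeval (funTranslate k c))
    (Polynomial.X_sub_one_pow_pred_char_pow (k := k) (p := p) r)
  simp only [map_pow, map_sub, Polynomial.aeval_X, map_one, map_sum] at h
  rw [h]
  funext i
  rw [LinearMap.sum_apply, Finset.sum_apply]
  simp only [translate_pow_apply, hrepc, hwc]
  obtain ⟨j, hj, hji⟩ := hrep i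
  rw [Finset.sum_eq_single_of_mem j (Finset.mem_range.2 hj), if_pos hji]
  intro j' hj' hne
  refine if_neg fun h' => hne ?_
  have h2 : j' • c = j • c := add_left_cancel (h'.trans hji.symm)
  rw [← hc] at hj hj'
  exact nsmul_injOn_Iio_addOrderOf (Finset.mem_range.1 hj') hj h2

variable {c : ZMod L}

/-- Lifting `y` means solving a linear system over `k` whose right-hand side is the `ε`-part of the
equations at `y`. Periodicity makes that side a norm, and norms are solvable because the cokernel is
small. -/
theorem exists_lift_of_periodic {α : kˣ} {τ : (DualNumber k)ˣ}
    (hτ : Units.map (TrivSqZeroExt.fstHom k k k : DualNumber k →+* k) τ = α) {r : ℕ}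
    (hq : 3 ≤ p ^ r) (hc : addOrderOf c = p ^ r) (hov : ∀ i, ov (i + c) = ov i)
    (hsg : ∀ i, sg (i + c) = sg i) (hprt : ∀ i, prt (i + c) = prt i + c)
    (hdim : Module.finrank k (LinearMap.ker (semiarcMap α ov sg prt)) ≤ 2) (y : ZMod L → k)
    (hy : semiarcMap α ov sg prt y = 0) :
    ∃ f : ZMod L → DualNumber k, semiarcMap τ ov sg prt f = 0 ∧ ∀ i, (f i).fst = y i := by
  set A := semiarcMap α ov sg prt with hA
  let N : Module.End k (ZMod L → k) := funTranslate k c - 1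
  have hNapp : ∀ f i, N f i = f (i + c) - f i := fun f i => rfl
  have hcomm : ∀ f, A (N f) = N (A f) := by
    intro f
    have h1 : N f = (fun i => f (i + c)) - f := rfl
    rw [h1, map_sub]
    funext i
    rw [hNapp, Pi.sub_apply, hA, semiarcMap_translate hov hsg hprt]
  have hN : IsNilpotent N := ⟨p ^ r, translate_sub_one_pow c r (hc ▸ addOrderOf_nsmul_eq_zero c)⟩
  have hNy : ∃ a : k, N y = fun _ => a := by
    have hmaps : ∀ f ∈ LinearMap.ker A, N f ∈ LinearMap.ker A := by
      intro f hf
      rw [LinearMap.mem_ker] at hf ⊢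
      rw [hcomm, hf, map_zero]
    let e : LinearMap.ker A := ⟨fun _ => 1, semiarcMap_const 1⟩
    have he : e ≠ 0 := fun h => one_ne_zero (congrFun (congrArg Subtype.val h) (0 : ZMod L))
    have hN' : IsNilpotent (N.restrict hmaps) := by
      obtain ⟨n, hn⟩ := hN
      refine ⟨n, ?_⟩
      rw [Module.End.pow_restrict n hmaps]
      ext f
      simp [hn]
    have hW : Submodule.span k {e} ≤ (Submodule.span k {e}).comap (N.restrict hmaps) := by
      rw [Submodule.span_le, Set.singleton_subset_iff]
      have : (N.restrict hmaps) e = 0 := by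
        apply Subtype.ext
        funext i
        exact sub_self _
      simp [this]
    -- Modulo the constants the kernel is at most a line, on which the nilpotent `N` is zero. Hence
    -- `N y` is constant.
    have hd : Module.finrank k (LinearMap.ker A ⧸ Submodule.span k {e}) ≤ 1 := by
      have h1 := Submodule.finrank_quotient_add_finrank (Submodule.span k {e})
      rw [finrank_span_singleton he] at h1
      omega
    have h2 := Module.End.pow_apply_mem_of_isNilpotent hN' hW hd ⟨y, hy⟩
    rw [pow_one, Submodule.mem_span_singleton] at h2
    obtain ⟨a, ha⟩ := h2
    refine ⟨a, ?_⟩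
    have h3 := congrArg Subtype.val ha
    rw [LinearMap.coe_restrict_apply] at h3
    rw [← h3]
    funext i
    simp [e]
  obtain ⟨a, ha⟩ := hNy
  -- The error of the trivial lift. It is a multiple of `ε`, and it is invariant because translation
  -- changes `y` by a constant, which satisfies the equations.
  set F := semiarcMap τ ov sg prt (fun i => TrivSqZeroExt.inl (y i)) with hF
  have hF1 : ∀ i, (F i).fst = 0 := by
    intro i
    have := map_semiarcMap (t := τ) (ov := ov) (sg := sg) (prt := prt)
      (TrivSqZeroExt.fstHom k k k : DualNumber k →+* k) (fun i => TrivSqZeroExt.inl (y i)) i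
    rw [hτ] at this
    exact this.trans (congrFun hy i)
  have hFc : ∀ i, F (i + c) = F i := by
    intro i
    rw [hF, ← semiarcMap_translate hov hsg hprt]
    have h1 : (fun j => (TrivSqZeroExt.inl (y (j + c)) : DualNumber k)) =
        (fun j => TrivSqZeroExt.inl (y j)) + fun _ => TrivSqZeroExt.inl a := by
      funext j
      have : y (j + c) = y j + a := by
        have := congrFun ha j
        rw [hNapp] at this
        linear_combination this
      simp [this]
    rw [h1, map_add, semiarcMap_const, add_zero]
  obtain ⟨w₀, hw₀⟩ := exists_translate_sub_one_pow_pred (k := k) c r hc (fun i => (F i).snd)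
    (fun i => by rw [hFc])
  have hrange : (fun i => (F i).snd) ∈ LinearMap.range A := by
    have hW : LinearMap.range A ≤ (LinearMap.range A).comap N := by
      rintro _ ⟨f, rfl⟩
      exact ⟨N f, hcomm f⟩
    -- The cokernel has the dimension of the kernel, at most `2`; this is where `p ^ r ≥ 3` enters.
    have hd : Module.finrank k ((ZMod L → k) ⧸ LinearMap.range A) ≤ p ^ r - 1 := by
      have h1 := Submodule.finrank_quotient_add_finrank (LinearMap.range A)
      have h2 := LinearMap.finrank_range_add_finrank_ker A
      omega
    rw [hw₀]
    exact Module.End.pow_apply_mem_of_isNilpotent hN hW hd w₀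
  obtain ⟨v, hv⟩ := hrange
  refine ⟨(fun i => TrivSqZeroExt.inl (y i)) - fun i => TrivSqZeroExt.inr (v i), ?_, ?_⟩
  · rw [map_sub, semiarcMap_inr hτ, ← hA, hv, ← hF, sub_eq_zero]
    funext i
    exact TrivSqZeroExt.ext (hF1 i) rfl
  · intro i
    simp

/-- For a word with a symmetry of order `p ^ r ≥ 3`, all colourings lift to the dual numbers. -/
theorem card_ker_sq_le_of_periodic [Finite k] {α : kˣ} {τ : (DualNumber k)ˣ}
    (hτ : Units.map (TrivSqZeroExt.fstHom k k k : DualNumber k →+* k) τ = α) {r : ℕ}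
    (hq : 3 ≤ p ^ r) (hc : addOrderOf c = p ^ r) (hov : ∀ i, ov (i + c) = ov i)
    (hsg : ∀ i, sg (i + c) = sg i) (hprt : ∀ i, prt (i + c) = prt i + c)
    (hcard : Nat.card (LinearMap.ker (semiarcMap α ov sg prt)) ≤ Nat.card k ^ 2) :
    Nat.card (LinearMap.ker (semiarcMap α ov sg prt)) ^ 2 ≤
      Nat.card (LinearMap.ker (semiarcMap τ ov sg prt)) := by
  have hdim : Module.finrank k (LinearMap.ker (semiarcMap α ov sg prt)) ≤ 2 := by
    rw [Module.natCard_eq_pow_finrank (K := k)] at hcard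
    exact (Nat.pow_le_pow_iff_right Finite.one_lt_card).1 hcard
  have hlift := fun y : LinearMap.ker (semiarcMap α ov sg prt) =>
    exists_lift_of_periodic hτ hq hc hov hsg hprt hdim y.1 y.2
  choose g hg hg' using hlift
  have : Finite (DualNumber k) := inferInstanceAs (Finite (k × k))
  rw [sq, ← Nat.card_prod]
  -- A chosen lift of one colouring plus `ε` times another; both are recovered from the two
  -- components.
  refine Nat.card_le_card_of_injective (fun z => (⟨g z.1 + fun i => TrivSqZeroExt.inr (z.2.1 i), ?_⟩ :
    LinearMap.ker (semiarcMap τ ov sg prt))) ?_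
  · rw [LinearMap.mem_ker, map_add, hg, semiarcMap_inr hτ, zero_add]
    funext i
    rw [z.2.2]
    rfl
  · rintro ⟨y, v⟩ ⟨y', v'⟩ h
    have h' : ∀ i, g y i + TrivSqZeroExt.inr (v.1 i) = g y' i + TrivSqZeroExt.inr (v'.1 i) :=
      fun i => congrFun (congrArg Subtype.val h) i
    have e1 : y = y' := by
      apply Subtype.ext
      funext i
      have := congrArg TrivSqZeroExt.fst (h' i)
      simpa [hg'] using this
    subst e1
    have e2 : v = v' := by
      apply Subtype.ext
      funext i
      exact TrivSqZeroExt.inr_injective (add_left_cancel (h' i))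
    rw [e2]

end Periodic

/-! ### Colourings by semi-arcs -/

section Semiarcs

variable {X : Type*} [CommRing X] {t : Xˣ}

theorem transport_iff_exists {c : ℕ → X} {w : List GaussLetter} {x y : X} :
    Transport t c w x y ↔ ∃ f : ℕ → X, f 0 = x ∧ f w.length = y ∧
      ∀ i (h : i < w.length), (w[i].isOver = true → f i = c w[i].label) ∧
        f (i + 1) = if w[i].isOver = true then f i
          else alexAct t w[i].isPos (f i) (c w[i].label) := by
  induction w generalizing x with
  | nil =>
    constructor
    · rintro rfl
      exact ⟨fun _ => x, rfl, rfl, by simp⟩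
    · rintro ⟨f, rfl, rfl, -⟩
      rfl
  | cons l w ih =>
    rw [transport_cons, ih]
    constructor
    · rintro ⟨h1, f, h2, h3, h4⟩
      refine ⟨fun n => Nat.casesOn n x f, rfl, h3, ?_⟩
      rintro (_ | i) hi
      · exact ⟨h1, h2⟩
      · simpa using h4 i (by simpa using hi)
    · rintro ⟨f, rfl, h3, h4⟩
      have h0 := h4 0 (by simp)
      refine ⟨h0.1, fun n => f (n + 1), h0.2, h3, fun i hi => ?_⟩
      exact h4 (i + 1) (by simpa using hi)

namespace GaussCode

variable (C : GaussCode) [NeZero C.word.length]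

/-- The letters of a Gauss code, indexed cyclically. -/
def letter (i : ZMod C.word.length) : GaussLetter := C.word.get ⟨i.val, ZMod.val_lt i⟩

variable {C}

theorem letter_mem (i : ZMod C.word.length) : C.letter i ∈ C.word := List.get_mem _ _

theorem letter_natCast {n : ℕ} (h : n < C.word.length) :
    C.letter (n : ZMod C.word.length) = C.word[n] := by
  simp [letter, ZMod.val_natCast_of_lt h]

theorem exists_letter_eq {l : GaussLetter} (h : l ∈ C.word) : ∃ i, C.letter i = l := by
  obtain ⟨n, hn, rfl⟩ := List.getElem_of_mem h
  exact ⟨n, letter_natCast hn⟩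

theorem letter_inj {i j : ZMod C.word.length} (h1 : (C.letter i).label = (C.letter j).label)
    (h2 : (C.letter i).isOver = (C.letter j).isOver) : i = j := by
  have h : (C.word.map fun x => (x.label, x.isOver))[i.val]'(by simpa using ZMod.val_lt i) =
      (C.word.map fun x => (x.label, x.isOver))[j.val]'(by simpa using ZMod.val_lt j) := by
    simpa [letter] using And.intro h1 h2
  exact ZMod.val_injective _ ((C.nodup.getElem_inj_iff).1 h)

theorem exists_partner (i : ZMod C.word.length) : ∃ j, C.letter j = (C.letter i).other :=
  exists_letter_eq (C.other_mem _ (letter_mem i))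

variable (C) in
/-- The position of the other letter of the same crossing. -/
noncomputable def partner (i : ZMod C.word.length) : ZMod C.word.length :=
  (exists_partner i).choose

theorem letter_partner (i : ZMod C.word.length) : C.letter (C.partner i) = (C.letter i).other :=
  (exists_partner i).choose_spec

theorem natCast_val_succ (i : ZMod C.word.length) :
    ((i.val + 1 : ℕ) : ZMod C.word.length) = i + 1 := by simp

variable (t C) in
/-- The equations of the colourings of the semi-arcs of a Gauss code. -/
noncomputable def semiarcEquations :
    (ZMod C.word.length → X) →ₗ[X] (ZMod C.word.length → X) :=
  semiarcMap t (fun i => (C.letter i).isOver) (fun i => (C.letter i).isPos) C.partner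

theorem semiarcEquations_eq_zero {F : ZMod C.word.length → X} :
    C.semiarcEquations t F = 0 ↔ ∀ i, F (i + 1) = if (C.letter i).isOver = true then F i
      else alexAct t (C.letter i).isPos (F i) (F (C.partner i)) := by
  simp only [funext_iff, semiarcEquations, semiarcMap_apply, sub_eq_zero, Pi.zero_apply]

/-- The coordinate `F i` is the colour of the semi-arc entering letter `i`. In these coordinates
colourings form the kernel of an endomorphism, on which a cyclic symmetry of the code acts. -/
theorem encard_colorings_le_semiarc : (colorings t C.word).encard ≤
    (LinearMap.ker (C.semiarcEquations t) : Set (ZMod C.word.length → X)).encard := by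
  have key : ∀ z ∈ colorings t C.word, ∃ F : ZMod C.word.length → X, F 0 = z.1 ∧
      ∀ i, ((C.letter i).isOver = true → F i = z.2 (C.letter i).label) ∧
        F (i + 1) = if (C.letter i).isOver = true then F i
          else alexAct t (C.letter i).isPos (F i) (z.2 (C.letter i).label) := by
    rintro ⟨x, c⟩ ⟨h1, -⟩
    obtain ⟨f, h2, h3, h4⟩ := transport_iff_exists.1 h1
    refine ⟨fun i => f i.val, by simpa using h2, fun i => ?_⟩
    have h5 := h4 i.val (ZMod.val_lt i)
    refine ⟨h5.1, Eq.trans ?_ h5.2⟩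
    have hi : i.val + 1 ≤ C.word.length := ZMod.val_lt i
    rcases hi.lt_or_eq with hi | hi
    · change f _ = _
      rw [← natCast_val_succ, ZMod.val_natCast_of_lt hi]
    · change f _ = _
      rw [hi, h3, ← natCast_val_succ, hi, ZMod.natCast_self, ZMod.val_zero, h2]
  choose! F hF0 hF using key
  refine Set.encard_le_encard_of_injOn (f := F) ?_ ?_
  · intro z hz
    refine semiarcEquations_eq_zero.2 fun i => ?_
    rw [(hF z hz i).2]
    by_cases hi : (C.letter i).isOver = true
    · simp [hi]
    · have := (hF z hz (C.partner i)).1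
      rw [letter_partner] at this
      simp only [GaussLetter.other, hi, Bool.not_false, forall_const] at this
      simp [hi, this]
  · intro z hz z' hz' h
    refine Prod.ext ?_ (funext fun a => ?_)
    · rw [← hF0 z hz, ← hF0 z' hz', h]
    · by_cases ha : ∀ l ∈ C.word, l.label ≠ a
      · rw [hz.2 a ha, hz'.2 a ha]
      · push Not at ha
        obtain ⟨l, hl, rfl⟩ := ha
        have : ∃ i, (C.letter i).isOver = true ∧ (C.letter i).label = l.label := by
          by_cases hl' : l.isOver = true
          · obtain ⟨i, hi⟩ := exists_letter_eq hl
            exact ⟨i, by rw [hi, hl'], by rw [hi]⟩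
          · obtain ⟨i, hi⟩ := exists_letter_eq (C.other_mem l hl)
            exact ⟨i, by simp [hi, GaussLetter.other, hl'], by rw [hi]; rfl⟩
        obtain ⟨i, hi, hi'⟩ := this
        rw [← hi', ← (hF z hz i).1 hi, ← (hF z' hz' i).1 hi, h]

theorem semiarc_le_encard_colorings :
    (LinearMap.ker (C.semiarcEquations t) : Set (ZMod C.word.length → X)).encard ≤
      (colorings t C.word).encard := by
  classical
  -- The default `0` on labels outside the word is the normalisation built into `colorings`.
  let c : (ZMod C.word.length → X) → ℕ → X := fun F a =>
    if h : ∃ i, (C.letter i).isOver = true ∧ (C.letter i).label = a then F h.choose else 0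
  have hc : ∀ F i, (C.letter i).isOver = true → c F (C.letter i).label = F i := by
    intro F i hi
    have h : ∃ j, (C.letter j).isOver = true ∧ (C.letter j).label = (C.letter i).label := ⟨i, hi, rfl⟩
    simp only [c, dif_pos h]
    rw [letter_inj h.choose_spec.2 (h.choose_spec.1.trans hi.symm)]
  have hc' : ∀ F i, (C.letter i).isOver = false → c F (C.letter i).label = F (C.partner i) := by
    intro F i hi
    rw [← hc F (C.partner i) (by simp [letter_partner, GaussLetter.other, hi]), letter_partner]
    rfl
  refine Set.encard_le_encard_of_injOn (f := fun F => (F 0, c F)) ?_ ?_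
  · intro F hF
    have hF' := semiarcEquations_eq_zero.1 hF
    refine ⟨transport_iff_exists.2 ⟨fun n => F n, by simp, by simp, fun n hn => ?_⟩, fun a ha => ?_⟩
    · have h := hF' n
      rw [← letter_natCast hn]
      refine ⟨fun h' => (hc F _ h').symm, ?_⟩
      beta_reduce
      rw [Nat.cast_succ, h]
      by_cases h' : (C.letter n).isOver = true
      · simp [h']
      · simp [h', hc' F _ (by simpa using h')]
    · refine dif_neg ?_
      rintro ⟨i, -, hi⟩
      exact ha _ (letter_mem i) hi
  · intro F hF F' hF' h
    simp only [Prod.mk.injEq] at h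
    have key : ∀ n : ℕ, F n = F' n := by
      intro n
      induction n with
      | zero => simpa using h.1
      | succ n ih =>
        rw [Nat.cast_succ, semiarcEquations_eq_zero.1 hF, semiarcEquations_eq_zero.1 hF', ih]
        by_cases h' : (C.letter n).isOver = true
        · simp [h']
        · simp only [Bool.not_eq_true] at h'
          rw [← hc' F _ h', ← hc' F' _ h', h.2]
    funext i
    simpa using key i.val

theorem encard_colorings_eq_semiarc : (colorings t C.word).encard =
    (LinearMap.ker (C.semiarcEquations t) : Set (ZMod C.word.length → X)).encard :=
  le_antisymm encard_colorings_le_semiarc semiarc_le_encard_colorings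

end GaussCode

end Semiarcs

/-! ### Colourings of torus knots -/

section Torus

variable {X : Type*} [CommRing X] {t : Xˣ}

theorem transport_flatMap_range {c : ℕ → X} (g : ℕ → List GaussLetter) {N : ℕ} {x y : X} :
    Transport t c ((List.range N).flatMap g) x y ↔ ∃ f : ℕ → X, f 0 = x ∧ f N = y ∧
      ∀ s < N, Transport t c (g s) (f s) (f (s + 1)) := by
  induction N generalizing y with
  | zero =>
    constructor
    · rintro rfl
      exact ⟨fun _ => x, rfl, rfl, by simp⟩
    · rintro ⟨f, rfl, rfl, -⟩
      rfl
  | succ N ih =>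
    rw [List.range_succ, List.flatMap_append, transport_append]
    simp only [ih, List.flatMap_cons, List.flatMap_nil, List.append_nil]
    constructor
    · rintro ⟨z, ⟨f, rfl, rfl, hf⟩, hz⟩
      refine ⟨Function.update f (N + 1) y, by simp, by simp, fun s hs => ?_⟩
      have h1 : s ≠ N + 1 := by omega
      rcases (Nat.lt_succ_iff.1 hs).lt_or_eq with h | rfl
      · have h2 : s + 1 ≠ N + 1 := by omega
        simpa only [Function.update_of_ne h1, Function.update_of_ne h2] using hf s h
      · simpa only [Function.update_of_ne h1, Function.update_self] using hz
    · rintro ⟨f, h0, hN, hf⟩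
      exact ⟨f N, ⟨f, h0, rfl, fun s hs => hf s (hs.trans (Nat.lt_succ_self N))⟩,
        hN ▸ hf N (Nat.lt_succ_self N)⟩

theorem transport_over {c : ℕ → X} {w : List GaussLetter} (hw : ∀ l ∈ w, l.isOver = true) {x y : X} :
    Transport t c w x y ↔ (∀ l ∈ w, x = c l.label) ∧ x = y := by
  induction w with
  | nil => simp
  | cons l w ih =>
    simp only [List.mem_cons, forall_eq_or_imp] at hw
    simp [hw.1, ih hw.2, and_assoc]

theorem transport_torusPassage {c : ℕ → X} {m n s : ℕ} {x y : X} :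
    Transport t c (torusPassage m n s) x y ↔
      if s % m = m - 1 then (∀ a < m - 1, x = c (Nat.pair (s % n) a)) ∧ x = y
      else y = t * x + (1 - t) * c (Nat.pair (s % n) (s % m)) := by
  unfold torusPassage
  split_ifs with h
  · rw [transport_over (by simp)]
    simp
  · simp [alexAct, signPow, eq_comm]

theorem torusPassage_mod {m n s : ℕ} : torusPassage m n (s % (m * n)) = torusPassage m n s := by
  simp [torusPassage]

theorem exists_mod_eq {m n : ℕ} (hmn : m.Coprime n) {a b : ℕ} (ha : a < m) (hb : b < n) :
    ∃ s < m * n, s % m = a ∧ s % n = b := by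
  have hm : m ≠ 0 := by omega
  have hn : n ≠ 0 := by omega
  refine ⟨Nat.chineseRemainder hmn a b, Nat.chineseRemainder_lt_mul hmn _ _ hm hn, ?_, ?_⟩
  · have := (Nat.chineseRemainder hmn a b).2.1
    rwa [Nat.ModEq, Nat.mod_eq_of_lt ha] at this
  · have := (Nat.chineseRemainder hmn a b).2.2
    rwa [Nat.ModEq, Nat.mod_eq_of_lt hb] at this

theorem label_torusWord {m n : ℕ} (hmn : m.Coprime n) {b : ℕ} :
    (∃ l ∈ torusWord m n, l.label = b) ↔ b.unpair.1 < n ∧ b.unpair.2 < m - 1 := by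
  constructor
  · rintro ⟨l, hl, rfl⟩
    obtain ⟨s, hs, hl⟩ := List.mem_flatMap.1 hl
    rw [List.mem_range] at hs
    have hm : 0 < m := Nat.pos_of_ne_zero (by rintro rfl; simp at hs)
    have hn : 0 < n := Nat.pos_of_ne_zero (by rintro rfl; simp at hs)
    have := Nat.mod_lt s hm
    rcases mem_torusPassage.1 hl with ⟨-, y, hy, rfl⟩ | ⟨h, rfl⟩
    · simp [Nat.mod_lt s hn, hy]
    · simp only [Nat.unpair_pair, Nat.mod_lt s hn, true_and]
      omega
  · rintro ⟨h1, h2⟩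
    obtain ⟨s, hs, hs1, hs2⟩ := exists_mod_eq hmn (show m - 1 < m by omega) h1
    refine ⟨⟨Nat.pair (s % n) b.unpair.2, true, true⟩, List.mem_flatMap.2 ⟨s, List.mem_range.2 hs,
      mem_torusPassage.2 (Or.inl ⟨hs1, _, h2, rfl⟩)⟩, ?_⟩
    rw [hs2]
    exact Nat.pair_unpair b

variable {m n : ℕ}

/-- The colouring of a torus knot is given by the colours of its `n` over-strands. -/
theorem exists_of_mem_colorings_torus (hm : 2 ≤ m) (hn : 2 ≤ n) (hmn : m.Coprime n)
    {z : X × (ℕ → X)} (hz : z ∈ colorings t (torusWord m n)) :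
    (∀ b, z.2 b = if b.unpair.1 < n ∧ b.unpair.2 < m - 1 then z.2 (Nat.pair b.unpair.1 0) else 0) ∧
    ∃ f : ℕ → X, f 0 = z.1 ∧ (∀ s, f (s + m * n) = f s) ∧
      (∀ s, f (s + 1) = t * f s + (1 - t) * z.2 (Nat.pair (s % n) 0)) ∧
      ∀ s, s % m = m - 1 → f s = z.2 (Nat.pair (s % n) 0) ∧ f (s + 1) = f s := by
  obtain ⟨h1, h2⟩ := hz
  obtain ⟨f₀, h3, h4, h5⟩ := (transport_flatMap_range _).1 h1
  have hpos : 0 < m * n := by positivity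
  -- The colours before the passages, extended periodically; the word closes up, so `f₀ (m * n) = f₀
  -- 0`.
  let f : ℕ → X := fun s => f₀ (s % (m * n))
  have hf : ∀ s, Transport t z.2 (torusPassage m n s) (f s) (f (s + 1)) := by
    intro s
    have h6 := h5 (s % (m * n)) (Nat.mod_lt _ hpos)
    rw [torusPassage_mod] at h6
    have h7 : f (s + 1) = f₀ (s % (m * n) + 1) := by
      have h8 : s % (m * n) + 1 ≤ m * n := Nat.mod_lt _ hpos
      simp only [f]
      rw [Nat.add_mod, Nat.mod_eq_of_lt (show 1 < m * n by nlinarith)]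
      rcases h8.lt_or_eq with h8 | h8
      · rw [Nat.mod_eq_of_lt h8]
      · rw [h8, Nat.mod_self, h3, h4]
    rwa [h7]
  simp only [transport_torusPassage] at hf
  have hover : ∀ s, s % m = m - 1 → (∀ a < m - 1, f s = z.2 (Nat.pair (s % n) a)) ∧
      f s = f (s + 1) := by
    intro s hs
    simpa [hs] using hf s
  have hlab : ∀ b < n, ∀ a < m - 1, z.2 (Nat.pair b a) = z.2 (Nat.pair b 0) := by
    intro b hb a ha
    obtain ⟨s, -, hs1, hs2⟩ := exists_mod_eq hmn (show m - 1 < m by omega) hb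
    have := (hover s hs1).1
    rw [← hs2, ← this a ha, ← this 0 (by omega)]
  refine ⟨fun b => ?_, f, by simpa [f] using h3, fun s => by simp [f], fun s => ?_, fun s hs =>
    ⟨(hover s hs).1 0 (by omega), (hover s hs).2.symm⟩⟩
  · split_ifs with hb
    · rw [← hlab _ hb.1 _ hb.2, Nat.pair_unpair]
    · refine h2 b fun l hl hlb => hb ((label_torusWord hmn).1 ⟨l, hl, hlb⟩)
  · by_cases hs : s % m = m - 1
    · obtain ⟨h6, h7⟩ := hover s hs
      rw [← h7, ← h6 0 (by omega)]
      ring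
    · have h6 := hf s
      rw [if_neg hs] at h6
      have := Nat.mod_lt s (show 0 < m by omega)
      rw [h6, hlab _ (Nat.mod_lt s (by omega)) _ (by omega)]

theorem mem_colorings_torus (hm : 2 ≤ m) (hn : 2 ≤ n) (hmn : m.Coprime n) (f G : ℕ → X)
    (hf0 : f (m * n) = f 0) (hG : ∀ s, G (s % n) = G s)
    (hf : ∀ s, f (s + 1) = t * f s + (1 - t) * G s) (hfG : ∀ s, s % m = m - 1 → f s = G s) :
    (f 0, fun b : ℕ => if b.unpair.1 < n ∧ b.unpair.2 < m - 1 then G b.unpair.1 else 0) ∈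
      colorings t (torusWord m n) := by
  refine ⟨(transport_flatMap_range _).2 ⟨f, rfl, hf0, fun s _ => ?_⟩, fun b hb => ?_⟩
  · have h0 := Nat.mod_lt s (show 0 < n by omega)
    have h1 := Nat.mod_lt s (show 0 < m by omega)
    rw [transport_torusPassage]
    split_ifs with hs
    · refine ⟨fun a ha => ?_, ?_⟩
      · simp [h0, ha, hG, hfG s hs]
      · rw [hf, hfG s hs]
        ring
    · have : s % m < m - 1 := by omega
      simp [h0, this, hG, hf]
  · refine if_neg fun h => ?_
    obtain ⟨l, hl, hlb⟩ := (label_torusWord hmn).2 h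
    exact hb l hl hlb

theorem exists_mul_modEq (hm : 2 ≤ m) (hn : 2 ≤ n) (hmn : m.Coprime n) (j : ℕ) :
    ∃ i, m * i ≡ j [MOD n] := by
  obtain ⟨s, -, hs1, hs2⟩ := exists_mod_eq hmn (show 0 < m by omega)
    (Nat.mod_lt j (show 0 < n by omega))
  obtain ⟨i, rfl⟩ := Nat.dvd_of_mod_eq_zero hs1
  exact ⟨i, hs2⟩

/-- The differences of the colours of consecutive over-strands are determined by the first one. -/
theorem torus_difference (hm : 2 ≤ m) (hn : 2 ≤ n) (hmn : m.Coprime n) {z : X × (ℕ → X)}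
    (hz : z ∈ colorings t (torusWord m n)) :
    (∀ i, z.2 (Nat.pair ((m * i + 1) % n) 0) - z.2 (Nat.pair (m * i % n) 0) =
      (t : X) ^ (m * i) * (z.2 (Nat.pair 1 0) - z.2 (Nat.pair 0 0))) ∧
    ((t : X) ^ (m * n) - 1) * (z.2 (Nat.pair 1 0) - z.2 (Nat.pair 0 0)) = 0 := by
  obtain ⟨-, f, -, -, hf, hfG⟩ := exists_of_mem_colorings_torus hm hn hmn hz
  set G : ℕ → X := fun s => z.2 (Nat.pair (s % n) 0) with hGdef
  have hG : ∀ s s', s % n = s' % n → G s = G s' := fun s s' h => by simp only [hGdef, h]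
  -- The passages from `s + 1` and from `s'` run through the same copies of the braid, so they meet
  -- the same over-colours and their difference is multiplied by `t` each time. After `m` passages
  -- each strand has been an over-strand again, which identifies both ends with values of `G`.
  have hstep : ∀ j, G (j + m + 1) - G (j + m) = t ^ m * (G (j + 1) - G j) := by
    intro j
    obtain ⟨s, -, hs1, hs2⟩ := exists_mod_eq hmn (show m - 1 < m by omega)
      (Nat.mod_lt j (show 0 < n by omega))
    obtain ⟨s', -, hs1', hs2'⟩ := exists_mod_eq hmn (show m - 1 < m by omega)
      (Nat.mod_lt (j + 1) (show 0 < n by omega))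
    have key : ∀ i, f (s' + i) - f (s + 1 + i) = t ^ i * (f s' - f (s + 1)) := by
      intro i
      induction i with
      | zero => simp
      | succ i ih =>
        have e : z.2 (Nat.pair ((s' + i) % n) 0) = z.2 (Nat.pair ((s + 1 + i) % n) 0) := by
          have : s' ≡ s + 1 [MOD n] :=
            (show s' ≡ j + 1 [MOD n] from hs2').trans ((show j ≡ s [MOD n] from hs2.symm).add_right 1)
          exact congrArg (fun r => z.2 (Nat.pair r 0)) (this.add_right i)
        rw [← add_assoc, ← add_assoc, hf, hf, e, pow_succ']
        linear_combination (t : X) * ih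
    have h1 := key m
    have hsm : (s + m) % m = m - 1 := by simpa using hs1
    rw [show s + 1 + m = s + m + 1 by ring, (hfG (s + m) hsm).2, (hfG (s + m) hsm).1,
      (hfG s hs1).2, (hfG s hs1).1, (hfG s' hs1').1, (hfG (s' + m) (by simpa using hs1')).1] at h1
    change G (s' + m) - G (s + m) = t ^ m * (G s' - G s) at h1
    have ej : s ≡ j [MOD n] := hs2
    have ej' : s' ≡ j + 1 [MOD n] := hs2'
    rw [hG s j ej, hG s' (j + 1) ej', hG (s + m) (j + m) (ej.add_right m),
      hG (s' + m) (j + m + 1) (by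
        rw [show j + m + 1 = j + 1 + m by ring]; exact ej'.add_right m)] at h1
    exact h1
  have hmul : ∀ i, G (m * i + 1) - G (m * i) = (t : X) ^ (m * i) * (G 1 - G 0) := by
    intro i
    induction i with
    | zero => simp
    | succ i ih =>
      rw [Nat.mul_succ, hstep, ih, pow_add]
      ring
  have e0 : z.2 (Nat.pair 0 0) = G 0 := by simp [hGdef]
  have e1 : z.2 (Nat.pair 1 0) = G 1 := by simp [hGdef, Nat.mod_eq_of_lt (show 1 < n by omega)]
  rw [e0, e1]
  refine ⟨hmul, ?_⟩
  · have h := hmul n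
    rw [hG (m * n) 0 (by simp), hG (m * n + 1) 1 (by simp [Nat.add_mod])] at h
    linear_combination -h

theorem torus_difference' (hm : 2 ≤ m) (hn : 2 ≤ n) (hmn : m.Coprime n) (j : ℕ) :
    ∃ i : ℕ, ∀ {X : Type*} [CommRing X] {t : Xˣ}, ∀ z ∈ colorings t (torusWord m n),
      z.2 (Nat.pair ((j + 1) % n) 0) - z.2 (Nat.pair (j % n) 0) =
        (t : X) ^ i * (z.2 (Nat.pair 1 0) - z.2 (Nat.pair 0 0)) := by
  obtain ⟨i, hi⟩ := exists_mul_modEq hm hn hmn j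
  refine ⟨m * i, fun z hz => ?_⟩
  rw [← (torus_difference hm hn hmn hz).1 i, show m * i % n = j % n from hi,
    show (m * i + 1) % n = (j + 1) % n from hi.add_right 1]

/-- The last passage, numbered `m * n - 1`, is an over-passage and returns to the base point without
changing colour. -/
theorem torus_baseColor (hm : 2 ≤ m) (hn : 2 ≤ n) (hmn : m.Coprime n) {z : X × (ℕ → X)}
    (hz : z ∈ colorings t (torusWord m n)) :
    z.1 = z.2 (Nat.pair ((m * n - 1) % n) 0) := by
  obtain ⟨-, f, hf0, hper, -, hfG⟩ := exists_of_mem_colorings_torus hm hn hmn hz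
  have hpos : 0 < m * n := by positivity
  have hmod : (m * n - 1) % m = m - 1 := by
    obtain ⟨n', rfl⟩ : ∃ n', n = n' + 1 := ⟨n - 1, by omega⟩
    rw [show m * (n' + 1) - 1 = m * n' + (m - 1) by rw [Nat.mul_succ]; omega, Nat.mul_add_mod]
    exact Nat.mod_eq_of_lt (by omega)
  have h := hfG _ hmod
  rw [← h.1, ← h.2, Nat.sub_add_cancel hpos, ← hf0]
  simpa using (hper 0).symm

theorem torus_coloring_ext (hm : 2 ≤ m) (hn : 2 ≤ n) (hmn : m.Coprime n) {z z' : X × (ℕ → X)}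
    (hz : z ∈ colorings t (torusWord m n)) (hz' : z' ∈ colorings t (torusWord m n))
    (h0 : z.2 (Nat.pair 0 0) = z'.2 (Nat.pair 0 0))
    (h1 : z.2 (Nat.pair 1 0) = z'.2 (Nat.pair 1 0)) : z = z' := by
  have key : ∀ j : ℕ, z.2 (Nat.pair (j % n) 0) = z'.2 (Nat.pair (j % n) 0) := by
    intro j
    induction j with
    | zero => simpa using h0
    | succ j ih =>
      obtain ⟨i, hi⟩ := torus_difference' hm hn hmn j
      have e := hi z hz
      have e' := hi z' hz'
      rw [h0, h1] at e
      linear_combination e - e' + ih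
  refine Prod.ext ?_ (funext fun b => ?_)
  · rw [torus_baseColor hm hn hmn hz, torus_baseColor hm hn hmn hz', key]
  · rw [(exists_of_mem_colorings_torus hm hn hmn hz).1, (exists_of_mem_colorings_torus hm hn hmn hz').1]
    split_ifs with hb
    · rw [← Nat.mod_eq_of_lt hb.1, key]
    · rfl

theorem encard_colorings_torus_le (hm : 2 ≤ m) (hn : 2 ≤ n) (hmn : m.Coprime n) :
    (colorings t (torusWord m n)).encard ≤ ENat.card X ^ 2 := by
  rw [sq, ← ENat.card_prod, ← Set.encard_univ]
  refine Set.encard_le_encard_of_injOn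
    (f := fun z => (z.2 (Nat.pair 0 0), z.2 (Nat.pair 1 0))) (fun _ _ => Set.mem_univ _) ?_
  rintro z hz z' hz' h
  simp only [Prod.mk.injEq] at h
  exact torus_coloring_ext hm hn hmn hz hz' h.1 h.2

theorem const_mem_colorings_torus (hm : 2 ≤ m) (hn : 2 ≤ n) (hmn : m.Coprime n) (x : X) :
    (x, fun b : ℕ => if b.unpair.1 < n ∧ b.unpair.2 < m - 1 then x else 0) ∈
      colorings t (torusWord m n) :=
  mem_colorings_torus hm hn hmn (fun _ => x) (fun _ => x) rfl (fun _ => rfl)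
    (fun _ => by ring) fun _ _ => rfl

/-- A non-constant colouring of a torus knot over a field. -/
theorem exists_nonconst_coloring_torus {k : Type*} [Field k] (hm : 2 ≤ m) (hn : 2 ≤ n)
    (hmn : m.Coprime n) {ζ ξ : k} {t : kˣ} (ht : (t : k) = ζ * ξ) (hζ : ζ ^ n = 1) (hξ : ξ ^ m = 1)
    (hζ1 : ζ ≠ 1) (hξ1 : ξ ≠ 1) :
    ∃ z ∈ colorings t (torusWord m n), z.2 (Nat.pair 0 0) ≠ z.2 (Nat.pair 1 0) := by
  have hζ0 : ζ ≠ 0 := by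
    rintro rfl
    exact t.ne_zero (by rw [ht, zero_mul])
  have hξs : ∀ s, s % m = m - 1 → ξ ^ (s + 1) = 1 := by
    intro s hs
    have : m ∣ s + 1 := by
      rw [Nat.dvd_iff_mod_eq_zero, Nat.add_mod, hs, Nat.mod_eq_of_lt (show 1 < m by omega),
        Nat.sub_add_cancel (by omega), Nat.mod_self]
    exact (orderOf_dvd_iff_pow_eq_one).1 ((orderOf_dvd_of_pow_eq_one hξ).trans this)
  -- With over-colours proportional to `ζ ^ s`, the recurrence is solved by a multiple of `ζ ^ s`
  -- plus a multiple of `(ζ * ξ) ^ s`. The coefficients make `f` agree with the over-colours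
  -- whenever `ξ ^ (s + 1) = 1`.
  refine ⟨_, mem_colorings_torus hm hn hmn
    (fun s => ζ ^ s * ((1 - ζ * ξ) + (ζ - 1) * ξ ^ (s + 1)))
    (fun s => ζ * (1 - ξ) * ζ ^ s) ?_ ?_ ?_ ?_, ?_⟩
  · have h1 : ζ ^ (m * n) = 1 := by rw [mul_comm, pow_mul, hζ, one_pow]
    have h2 : ξ ^ (m * n) = 1 := by rw [pow_mul, hξ, one_pow]
    simp [h1, pow_succ, h2]
  · intro s
    exact congrArg _ (pow_eq_pow_of_modEq (Nat.mod_modEq s n) hζ)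
  · intro s
    rw [ht]
    ring
  · intro s hs
    rw [hξs s hs]
    ring
  · have h1 : 0 < m - 1 := by omega
    have h2 : 0 < n := by omega
    have h3 : 1 < n := by omega
    simp only [Nat.unpair_pair, h1, h2, h3, true_and, if_true, pow_zero, pow_one, mul_one]
    intro h
    have : ζ * (1 - ξ) * (ζ - 1) = 0 := by linear_combination -h
    simp [hζ0, sub_eq_zero, hζ1, Ne.symm hξ1] at this

theorem card_lt_encard_colorings_torus {k : Type*} [Field k] [Finite k] (hm : 2 ≤ m) (hn : 2 ≤ n)
    (hmn : m.Coprime n) {ζ ξ : k} {t : kˣ} (ht : (t : k) = ζ * ξ) (hζ : ζ ^ n = 1) (hξ : ξ ^ m = 1)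
    (hζ1 : ζ ≠ 1) (hξ1 : ξ ≠ 1) :
    ENat.card k < (colorings t (torusWord m n)).encard := by
  obtain ⟨z, hz, hz01⟩ := exists_nonconst_coloring_torus hm hn hmn ht hζ hξ hζ1 hξ1
  let g : k → k × (ℕ → k) := fun x =>
    (x, fun b : ℕ => if b.unpair.1 < n ∧ b.unpair.2 < m - 1 then x else 0)
  have hg : Function.Injective g := fun x y h => congrArg Prod.fst h
  have hzg : z ∉ Set.range g := by
    rintro ⟨x, rfl⟩
    have h1 : 0 < m - 1 := by omega
    have h2 : 0 < n := by omega
    have h3 : 1 < n := by omega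
    simp [g, h1, h2, h3] at hz01
  have h1 : (insert z (Set.range g)).encard ≤ (colorings t (torusWord m n)).encard := by
    refine Set.encard_le_encard (Set.insert_subset hz ?_)
    rintro _ ⟨x, rfl⟩
    exact const_mem_colorings_torus hm hn hmn x
  rw [Set.encard_insert_of_notMem hzg, ← Set.image_univ, hg.encard_image, Set.encard_univ] at h1
  refine lt_of_lt_of_le ?_ h1
  exact (ENat.lt_add_one_iff (by simp; infer_instance)).2 le_rfl

/-- The `ε`-part of `τ` enters multiplied by a difference of constant parts. These all equal `g`, so
the `ε`-parts of the colours obey the rules for `α`. -/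
theorem transport_snd {k : Type*} [Field k] {α : kˣ} {τ : (DualNumber k)ˣ}
    (hτ : Units.map (TrivSqZeroExt.fstHom k k k : DualNumber k →+* k) τ = α) {g : k}
    {c : ℕ → DualNumber k} {w : List GaussLetter} {x y : DualNumber k} (hx : x.fst = g)
    (hc : ∀ l ∈ w, (c l.label).fst = g) (h : Transport τ c w x y) :
    Transport α (fun a => (c a).snd) w x.snd y.snd := by
  have hs : ∀ e, (signPow τ e : DualNumber k).fst = signPow α e := by
    intro e
    rw [← hτ, ← map_signPow]
    rfl
  induction w generalizing x with
  | nil => exact congrArg TrivSqZeroExt.snd h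
  | cons l w ih =>
    rw [transport_cons] at h ⊢
    have hl := hc l (by simp)
    have hc' := fun l hl => hc l (List.mem_cons_of_mem _ hl)
    refine ⟨fun h' => congrArg TrivSqZeroExt.snd (h.1 h'), ?_⟩
    by_cases h' : l.isOver = true
    · simp only [h', if_true] at h ⊢
      exact ih hx hc' h.2
    · simp only [h', Bool.false_eq_true, if_false] at h ⊢
      have := ih ?_ hc' h.2
      · convert this using 1
        simp [alexAct, hs, hl, hx]
        ring
      · simp [alexAct, hl, hx]
        ring

/-- If only constant colourings lift to the dual numbers, there are few colourings over them. -/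
theorem encard_colorings_torus_dual_le {k : Type*} [Field k] (hm : 2 ≤ m) (hn : 2 ≤ n)
    (hmn : m.Coprime n) {α : kˣ} {τ : (DualNumber k)ˣ}
    (hτ : Units.map (TrivSqZeroExt.fstHom k k k : DualNumber k →+* k) τ = α)
    (hroot : ∀ a : DualNumber k, ((τ : DualNumber k) ^ (m * n) - 1) * a = 0 → a.fst = 0) :
    (colorings τ (torusWord m n)).encard ≤
      ENat.card k * (colorings α (torusWord m n)).encard := by
  have hfst : ∀ z ∈ colorings τ (torusWord m n), ∀ j : ℕ,
      (z.2 (Nat.pair (j % n) 0)).fst = (z.2 (Nat.pair 0 0)).fst := by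
    intro z hz j
    induction j with
    | zero => simp
    | succ j ih =>
      obtain ⟨i, hi⟩ := torus_difference' hm hn hmn j
      have h1 := congrArg TrivSqZeroExt.fst (hi z hz)
      rw [TrivSqZeroExt.fst_mul, hroot _ (torus_difference hm hn hmn hz).2, mul_zero,
        TrivSqZeroExt.fst_sub, sub_eq_zero] at h1
      rw [h1, ih]
  have hin : ∀ z ∈ colorings τ (torusWord m n), ∀ b : ℕ, b.unpair.1 < n ∧ b.unpair.2 < m - 1 →
      (z.2 b).fst = (z.2 (Nat.pair 0 0)).fst := by
    intro z hz b hb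
    rw [(exists_of_mem_colorings_torus hm hn hmn hz).1, if_pos hb, ← Nat.mod_eq_of_lt hb.1,
      hfst z hz]
  have hbase : ∀ z ∈ colorings τ (torusWord m n), z.1.fst = (z.2 (Nat.pair 0 0)).fst := by
    intro z hz
    rw [torus_baseColor hm hn hmn hz, hfst z hz]
  rw [← Set.encard_univ, ← Set.encard_prod]
  -- A colouring is encoded by its common constant part and by its `ε`-parts, which form a colouring
  -- over `k`.
  refine Set.encard_le_encard_of_injOn
    (f := fun z => ((z.2 (Nat.pair 0 0)).fst, (z.1.snd, fun a => (z.2 a).snd))) ?_ ?_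
  · intro z hz
    refine ⟨Set.mem_univ _, transport_snd hτ (hbase z hz) ?_ hz.1, fun a ha => ?_⟩
    · exact fun l hl => hin z hz _ ((label_torusWord hmn).1 ⟨l, hl, rfl⟩)
    · exact congrArg TrivSqZeroExt.snd (hz.2 a ha)
  · intro z hz z' hz' h
    simp only [Prod.mk.injEq] at h
    obtain ⟨h1, h2, h3⟩ := h
    refine Prod.ext (TrivSqZeroExt.ext ?_ h2) (funext fun b => TrivSqZeroExt.ext ?_ (congrFun h3 b))
    · rw [hbase z hz, hbase z' hz', h1]
    · by_cases hb : b.unpair.1 < n ∧ b.unpair.2 < m - 1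
      · rw [hin z hz b hb, hin z' hz' b hb, h1]
      · rw [(exists_of_mem_colorings_torus hm hn hmn hz).1,
          (exists_of_mem_colorings_torus hm hn hmn hz').1, if_neg hb, if_neg hb]

end Torus

/-! ### A unit of the dual numbers detecting simple roots of unity. -/

section DualNumber

variable {k : Type*} [Field k]

/-- Take `τ = α + ε`: then `τ ^ N - 1 = N * α ^ (N - 1) * ε`, a nonzero multiple of `ε`, whose
annihilator consists of the multiples of `ε`. -/
theorem exists_dual_unit (α : kˣ) : ∃ τ : (DualNumber k)ˣ,
    Units.map (TrivSqZeroExt.fstHom k k k : DualNumber k →+* k) τ = α ∧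
      ∀ N : ℕ, (N : k) ≠ 0 → (α : k) ^ N = 1 →
        ∀ a : DualNumber k, ((τ : DualNumber k) ^ N - 1) * a = 0 → a.fst = 0 := by
  obtain ⟨τ, hτ⟩ : IsUnit (TrivSqZeroExt.inl (α : k) + DualNumber.eps : DualNumber k) := by
    rw [TrivSqZeroExt.isUnit_iff_isUnit_fst]
    simp
  refine ⟨τ, Units.ext ?_, fun N hN hα a ha => ?_⟩
  · simp [hτ]
  · have h := congrArg TrivSqZeroExt.snd ha
    rw [hτ] at h
    simp [TrivSqZeroExt.snd_pow, hα, hN] at h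
    exact h

end DualNumber

/-! ### The symmetry of the Gauss code of a periodic diagram -/

theorem planeDet_mul (ζ a b : ℂ) : planeDet (ζ * a) (ζ * b) = Complex.normSq ζ * planeDet a b := by
  simp only [planeDet, Complex.mul_re, Complex.mul_im, Complex.normSq_apply]
  ring

theorem planeDet_real_mul (r s : ℝ) (a b : ℂ) :
    planeDet (r * a) (s * b) = r * s * planeDet a b := by
  simp only [planeDet, Complex.re_ofReal_mul, Complex.im_ofReal_mul]
  ring

/-- A strictly monotone map of the integers that commutes with a translation is a translation. -/
theorem StrictMono.int_eq_add {σ : ℤ → ℤ} (hσ : StrictMono σ) {L : ℕ} (hL : 0 < L)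
    (h : ∀ z, σ (z + L) = σ z + L) (z : ℤ) : σ z = z + σ 0 := by
  have h1 : ∀ z (j : ℕ), σ z + j ≤ σ (z + j) := by
    intro z j
    induction j with
    | zero => simp
    | succ j ih =>
      have := hσ (show z + (j : ℕ) < z + (j + 1 : ℕ) by push_cast; omega)
      push_cast at this ⊢
      omega
  have h2 : ∀ z, σ (z + 1) = σ z + 1 := by
    intro z
    -- The remaining `L - 1` steps to `z + L` each raise `σ` by at least one, and the total over `L`
    -- steps is `L`; so the first step raises it by exactly one.
    have e1 := h1 (z + 1) (L - 1)
    have e2 := h1 z 1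
    rw [Nat.cast_sub (by omega : 1 ≤ L)] at e1
    rw [show z + 1 + ((L : ℤ) - (1 : ℕ)) = z + L by push_cast; ring, h] at e1
    push_cast at e1 e2
    omega
  induction z using Int.induction_on with
  | zero => simp
  | succ i ih => rw [h2, ih]; ring
  | pred i ih =>
    have := h2 (-(i : ℤ) - 1)
    rw [sub_add_cancel, ih] at this
    omega

namespace VirtualKnotDiagram

/-- A rotational symmetry does not reverse the orientation. -/
theorem strictMono_of_rotation {D : VirtualKnotDiagram} {φ : ℝ ≃ₜ ℝ} {ζ : ℂ} (hζ : ζ ≠ 1) (h0 : ∀ t, D.curve t ≠ 0)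
    (hφ : ∀ t, D.curve (φ t) = ζ * D.curve t) : StrictMono φ := by
  rcases φ.continuous.strictMono_of_inj φ.injective with h | h
  · exact h
  · exfalso
    -- A decreasing homeomorphism of the line has a fixed point; the curve there is fixed by
    -- multiplication by `ζ ≠ 1`, so it is the origin.
    obtain ⟨x, hx⟩ : ∃ x, φ x - x = 0 := by
      have hc : Continuous fun x => φ x - x := φ.continuous.sub continuous_id
      rcases le_total 0 (φ 0) with h1 | h1
      · exact mem_range_of_exists_le_of_exists_ge hc
          ⟨φ 0, sub_nonpos.2 (h.antitone h1)⟩ ⟨0, by simpa using h1⟩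
      · exact mem_range_of_exists_le_of_exists_ge hc
          ⟨0, by simpa using h1⟩ ⟨φ 0, sub_nonneg.2 (h.antitone h1)⟩
    have h1 := hφ x
    rw [sub_eq_zero.1 hx] at h1
    have h2 : (ζ - 1) * D.curve x = 0 := by linear_combination -h1
    rcases mul_eq_zero.1 h2 with h3 | h3
    · exact hζ (sub_eq_zero.1 h3)
    · exact h0 x h3

variable (D : VirtualKnotDiagram) [NeZero D.code.word.length]

/-- The times at which the letters are read, indexed cyclically. -/
noncomputable def letterTime (i : ZMod D.code.word.length) : ℝ := D.time ⟨i.val, ZMod.val_lt i⟩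

/-- All times at which letters are read, as a sequence indexed by the integers. -/
noncomputable def liftedTime (z : ℤ) : ℝ :=
  (z / (D.code.word.length : ℤ) : ℤ) + D.letterTime (z : ZMod D.code.word.length)

variable {D}

theorem letterTime_mem (i : ZMod D.code.word.length) : D.letterTime i ∈ Set.Ico (0 : ℝ) 1 :=
  D.time_mem _

theorem letterTime_lt {i j : ZMod D.code.word.length} (h : i.val < j.val) :
    D.letterTime i < D.letterTime j := D.time_strictMono h

theorem letterTime_injective : Function.Injective D.letterTime := by
  intro i j h
  have := D.time_strictMono.injective h
  exact ZMod.val_injective _ (congrArg Fin.val this)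

theorem letter_eq_get (i : ZMod D.code.word.length) :
    D.code.letter i = D.code.word.get ⟨i.val, ZMod.val_lt i⟩ := rfl

theorem liftedTime_strictMono : StrictMono D.liftedTime := by
  intro z z' h
  have hL : (0 : ℤ) < D.code.word.length := by exact_mod_cast NeZero.pos _
  have h1 := D.letterTime_mem (z : ZMod D.code.word.length)
  have h2 := D.letterTime_mem (z' : ZMod D.code.word.length)
  simp only [liftedTime]
  rcases (Int.ediv_le_ediv hL h.le).lt_or_eq with hd | hd
  · have : ((z / (D.code.word.length : ℤ) : ℤ) : ℝ) + 1 ≤ (z' / (D.code.word.length : ℤ) : ℤ) := by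
      exact_mod_cast hd
    linarith [h1.2, h2.1]
  · rw [hd]
    refine add_lt_add_right (letterTime_lt ?_) _
    zify
    rw [ZMod.val_intCast, ZMod.val_intCast]
    have e1 := Int.emod_add_mul_ediv z D.code.word.length
    have e2 := Int.emod_add_mul_ediv z' D.code.word.length
    rw [hd] at e1
    linarith

theorem liftedTime_add_length (z : ℤ) :
    D.liftedTime (z + D.code.word.length) = D.liftedTime z + 1 := by
  have hL : (D.code.word.length : ℤ) ≠ 0 := by exact_mod_cast NeZero.ne _
  simp only [liftedTime, Int.add_ediv_of_dvd_right (dvd_refl _), Int.ediv_self hL]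
  push_cast
  rw [ZMod.natCast_self, add_zero]
  ring

theorem time_add_int (j : Fin D.code.word.length) (k : ℤ) : ∃ z : ℤ,
    D.liftedTime z = D.time j + k ∧ D.code.letter z = D.code.word.get j := by
  have hL : (D.code.word.length : ℤ) ≠ 0 := by exact_mod_cast NeZero.ne _
  have hj : ((j.val : ZMod D.code.word.length)).val = j.val := ZMod.val_natCast_of_lt j.2
  refine ⟨j.val + D.code.word.length * k, ?_, ?_⟩
  · simp only [liftedTime, Int.add_mul_ediv_left _ _ hL,
      Int.ediv_eq_zero_of_lt (Int.natCast_nonneg _) (Int.ofNat_lt.2 j.2)]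
    push_cast
    rw [ZMod.natCast_self, zero_mul, add_zero, zero_add, add_comm]
    simp only [letterTime, hj]
  · push_cast
    rw [ZMod.natCast_self, zero_mul, add_zero, letter_eq_get]
    simp only [hj]

theorem curve_liftedTime (z : ℤ) : D.curve (D.liftedTime z) = D.curve (D.letterTime z) := by
  rw [liftedTime, add_comm]
  simpa using D.periodic.int_mul (z / (D.code.word.length : ℤ)) (D.letterTime z)

theorem deriv_curve_liftedTime (z : ℤ) :
    deriv D.curve (D.liftedTime z) = deriv D.curve (D.letterTime z) := by
  have h : Function.Periodic (deriv D.curve) 1 := by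
    intro x
    rw [← deriv_comp_add_const]
    exact congrArg (deriv · x) (funext D.periodic)
  rw [liftedTime, add_comm]
  simpa using h.int_mul (z / (D.code.word.length : ℤ)) (D.letterTime z)

theorem partner_ne (i : ZMod D.code.word.length) : D.code.partner i ≠ i := by
  intro h
  have := GaussCode.letter_partner (C := D.code) i
  rw [h] at this
  have := congrArg GaussLetter.isOver this
  simp [GaussLetter.other] at this

theorem curve_partner (i : ZMod D.code.word.length) :
    D.curve (D.letterTime (D.code.partner i)) = D.curve (D.letterTime i) := by
  refine D.crossing _ _ ?_
  rw [← letter_eq_get, ← letter_eq_get, GaussCode.letter_partner]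
  rfl

theorem eq_or_eq_partner {i j : ZMod D.code.word.length}
    (h : D.curve (D.letterTime j) = D.curve (D.letterTime i)) : j = i ∨ j = D.code.partner i := by
  rcases D.no_triple _ (letterTime_mem j) _ (letterTime_mem i) _ (letterTime_mem (D.code.partner i))
    h (curve_partner i).symm with h | h | h
  · exact .inl (letterTime_injective h)
  · exact absurd (letterTime_injective h).symm (partner_ne i)
  · exact .inr (letterTime_injective h)

theorem isPos_iff {i : ZMod D.code.word.length} (h : (D.code.letter i).isOver = true) :
    (D.code.letter i).isPos = true ↔ 0 < planeDet (deriv D.curve (D.letterTime i))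
      (deriv D.curve (D.letterTime (D.code.partner i))) := by
  have hp := GaussCode.letter_partner (C := D.code) i
  refine D.sign _ _ ?_ h ?_
  · rw [← letter_eq_get, ← letter_eq_get, hp]
    rfl
  · rw [← letter_eq_get, hp]
    simp [GaussLetter.other, h]

/-- On the discrete, periodic sequence of lifted reading times, `φ` induces an increasing map of the
indices that commutes with translation by the word length, hence a translation. -/
theorem exists_translation_of_rotation {φ : ℝ ≃ₜ ℝ} (hmono : StrictMono φ)
    (hφ1 : ∀ t, φ (t + 1) = φ t + 1)
    (hletters : ∀ i, ∃ j, ∃ k : ℤ, φ (D.time i) = D.time j + k ∧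
      (D.code.word.get j).isOver = (D.code.word.get i).isOver) :
    ∃ d : ℤ, ∀ z : ℤ, φ (D.liftedTime z) = D.liftedTime (z + d) ∧
      (D.code.letter ((z + d : ℤ) : ZMod D.code.word.length)).isOver =
        (D.code.letter (z : ZMod D.code.word.length)).isOver := by
  have hφZ : ∀ (k : ℤ) t, φ (t + k) = φ t + k := by
    intro k
    induction k using Int.induction_on with
    | zero => simp
    | succ k ih =>
      intro t
      push_cast
      rw [← add_assoc, hφ1]
      have := ih t
      push_cast at this
      rw [this]
      ring
    | pred k ih =>
      intro t
      have := hφ1 (t + ((-(k : ℤ) - 1 : ℤ) : ℝ))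
      rw [show t + ((-(k : ℤ) - 1 : ℤ) : ℝ) + 1 = t + ((-(k : ℤ) : ℤ) : ℝ) by push_cast; ring,
        ih] at this
      push_cast at this ⊢
      linarith
  have h : ∀ z : ℤ, ∃ z' : ℤ, φ (D.liftedTime z) = D.liftedTime z' ∧
      (D.code.letter (z' : ZMod D.code.word.length)).isOver =
        (D.code.letter (z : ZMod D.code.word.length)).isOver := by
    intro z
    obtain ⟨j, k, h1, h2⟩ := hletters ⟨(z : ZMod D.code.word.length).val, ZMod.val_lt _⟩
    obtain ⟨z', h3, h4⟩ := time_add_int j (k + z / (D.code.word.length : ℤ))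
    refine ⟨z', ?_, by rw [h4, h2]; rfl⟩
    rw [h3, liftedTime, add_comm, hφZ]
    change φ (D.time _) + _ = _
    rw [h1]
    push_cast
    ring
  choose σ hσ hσ' using h
  have hσm : StrictMono σ := by
    intro z z' hz
    rw [← (liftedTime_strictMono (D := D)).lt_iff_lt, ← hσ, ← hσ]
    exact hmono (liftedTime_strictMono hz)
  have hσL : ∀ z, σ (z + D.code.word.length) = σ z + D.code.word.length := by
    intro z
    apply (liftedTime_strictMono (D := D)).injective
    rw [← hσ, liftedTime_add_length, hφ1, hσ, liftedTime_add_length]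
  refine ⟨σ 0, fun z => ?_⟩
  rw [← hσm.int_eq_add (NeZero.pos _) hσL z]
  exact ⟨hσ z, hσ' z⟩

/-- The Gauss code of a diagram that is invariant under the rotation by `2π / q` has a cyclic
symmetry of order `q`. -/
theorem IsPeriodic.exists_symmetry {q : ℕ} (hq : 2 ≤ q) (hD : D.IsPeriodic q) :
    ∃ c : ZMod D.code.word.length, addOrderOf c = q ∧
      (∀ i, (D.code.letter (i + c)).isOver = (D.code.letter i).isOver) ∧
      (∀ i, (D.code.letter (i + c)).isPos = (D.code.letter i).isPos) ∧
      ∀ i, D.code.partner (i + c) = D.code.partner i + c := by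
  obtain ⟨h0, φ, hφ, -, hφ1, hrot, hletters⟩ := hD
  set ζ : ℂ := Complex.exp (2 * Real.pi * Complex.I / q) with hζdef
  have hζ : IsPrimitiveRoot ζ q := Complex.isPrimitiveRoot_exp q (by omega)
  have hmono : StrictMono φ := strictMono_of_rotation (hζ.ne_one (by omega)) h0 hrot
  have hφ1' : ∀ t, φ (t + 1) = φ t + 1 := by
    intro t
    refine (hφ1 t).resolve_right fun h => ?_
    have := hmono (show t < t + 1 by linarith)
    linarith
  obtain ⟨d, hd⟩ := exists_translation_of_rotation hmono hφ1' hletters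
  have hcurve : ∀ i : ZMod D.code.word.length,
      D.curve (D.letterTime (i + d)) = ζ * D.curve (D.letterTime i) := by
    intro i
    obtain ⟨z, rfl⟩ := ZMod.intCast_surjective i
    rw [← curve_liftedTime, ← hrot, (hd z).1, curve_liftedTime, Int.cast_add]
  have hover : ∀ i : ZMod D.code.word.length,
      (D.code.letter (i + d)).isOver = (D.code.letter i).isOver := by
    intro i
    obtain ⟨z, rfl⟩ := ZMod.intCast_surjective i
    simpa using (hd z).2
  -- The factor `r` is the derivative of `φ`: nonnegative by monotonicity, nonzero because the curve
  -- is immersed. Positive factors and a rotation preserve the signs of `planeDet`, hence those of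
  -- crossings.
  have hderiv : ∀ i : ZMod D.code.word.length, ∃ r : ℝ, 0 < r ∧
      r * deriv D.curve (D.letterTime (i + d)) = ζ * deriv D.curve (D.letterTime i) := by
    intro i
    obtain ⟨z, rfl⟩ := ZMod.intCast_surjective i
    have hdφ : HasDerivAt φ (deriv φ (D.liftedTime z)) (D.liftedTime z) :=
      (hφ.differentiable (by simp) _).hasDerivAt
    have hdc : ∀ x, HasDerivAt D.curve (deriv D.curve x) x := fun x =>
      (D.smooth.differentiable (by simp) x).hasDerivAt
    have e1 := (hdc (φ (D.liftedTime z))).scomp (D.liftedTime z) hdφ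
    have e2 := (hdc (D.liftedTime z)).const_mul ζ
    rw [show D.curve ∘ φ = fun y => ζ * D.curve y from funext hrot] at e1
    have e3 := e1.unique e2
    rw [(hd z).1, deriv_curve_liftedTime, deriv_curve_liftedTime, Int.cast_add,
      Complex.real_smul] at e3
    refine ⟨_, lt_of_le_of_ne hmono.monotone.deriv_nonneg fun hr => ?_, e3⟩
    rw [← hr, Complex.ofReal_zero, zero_mul] at e3
    exact mul_ne_zero (hζ.ne_zero (by omega)) (D.immersion _) e3.symm
  have hpartner : ∀ i : ZMod D.code.word.length,
      D.code.partner (i + d) = D.code.partner i + d := by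
    intro i
    have h : D.curve (D.letterTime (D.code.partner i + d)) = D.curve (D.letterTime (i + d)) := by
      rw [hcurve, hcurve, curve_partner]
    rcases eq_or_eq_partner h with h | h
    · exact absurd (add_right_cancel h) (partner_ne i)
    · exact h.symm
  have hpos_over : ∀ i : ZMod D.code.word.length, (D.code.letter i).isOver = true →
      (D.code.letter (i + d)).isPos = (D.code.letter i).isPos := by
    intro i hi
    rw [Bool.eq_iff_iff, isPos_iff hi, isPos_iff ((hover i).trans hi), hpartner]
    obtain ⟨r, hr, e1⟩ := hderiv i
    obtain ⟨s, hs, e2⟩ := hderiv (D.code.partner i)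
    have h := planeDet_real_mul r s (deriv D.curve (D.letterTime (i + d)))
      (deriv D.curve (D.letterTime (D.code.partner i + d)))
    rw [e1, e2, planeDet_mul] at h
    have hn : 0 < Complex.normSq ζ := Complex.normSq_pos.2 (hζ.ne_zero (by omega))
    rw [← mul_pos_iff_of_pos_left (mul_pos hr hs), ← h, mul_pos_iff_of_pos_left hn]
  have hpos : ∀ i : ZMod D.code.word.length,
      (D.code.letter (i + d)).isPos = (D.code.letter i).isPos := by
    intro i
    by_cases hi : (D.code.letter i).isOver = true
    · exact hpos_over i hi
    · have e := fun j => congrArg GaussLetter.isPos (GaussCode.letter_partner (C := D.code) j)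
      have e1 := e i
      have e2 := e (i + d)
      simp only [GaussLetter.other] at e1 e2
      rw [← e1, ← e2, hpartner]
      refine hpos_over _ ?_
      rw [GaussCode.letter_partner]
      simpa [GaussLetter.other] using hi
  have hcurve_nsmul : ∀ j : ℕ, D.curve (D.letterTime (j • (d : ZMod D.code.word.length))) =
      ζ ^ j * D.curve (D.letterTime 0) := by
    intro j
    induction j with
    | zero => simp
    | succ j ih => rw [succ_nsmul, hcurve, ih, pow_succ']; ring
  have hover_nsmul : ∀ j : ℕ, (D.code.letter (j • (d : ZMod D.code.word.length))).isOver =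
      (D.code.letter 0).isOver := by
    intro j
    induction j with
    | zero => simp
    | succ j ih => rw [succ_nsmul, hover, ih]
  -- After `q` shifts the curve is back at the same double point, and the over/under type excludes
  -- the other passage. Conversely, a shift returning to the same letter rotates a nonzero point to
  -- itself.
  refine ⟨d, Nat.dvd_antisymm ?_ ?_, hover, hpos, hpartner⟩
  · apply addOrderOf_dvd_of_nsmul_eq_zero
    have h := hcurve_nsmul q
    rw [hζ.pow_eq_one, one_mul] at h
    refine (eq_or_eq_partner h).resolve_right fun h' => ?_
    have h1 := hover_nsmul q
    rw [h', GaussCode.letter_partner] at h1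
    simp [GaussLetter.other] at h1
  · apply hζ.dvd_of_pow_eq_one
    have h := hcurve_nsmul (addOrderOf (d : ZMod D.code.word.length))
    rw [addOrderOf_nsmul_eq_zero] at h
    exact mul_right_cancel₀ (h0 _) (h.symm.trans (one_mul _).symm)

end VirtualKnotDiagram

/-! ### Comparison of the numbers of colourings. -/

theorem encard_colorings_nil_le {X : Type*} [CommRing X] (t : Xˣ) :
    (colorings t []).encard ≤ ENat.card X := by
  rw [← Set.encard_univ]
  refine Set.encard_le_encard_of_injOn (f := Prod.fst) (fun _ _ => Set.mem_univ _) ?_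
  intro z hz z' hz' h
  exact Prod.ext h (funext fun a => by rw [hz.2 a (by simp), hz'.2 a (by simp)])

/-- A virtual knot with a period `p ^ r ≥ 3` that has at most `|k| ^ 2` colourings over a finite
field `k` of characteristic `p`, but more than `|k|`, has the square of that number of colourings
over the dual numbers. -/
theorem VirtualKnot.HasPeriod.encard_colorings_sq_le {k : Type*} [Field k] [Finite k] {p : ℕ}
    [Fact p.Prime] [CharP k p] {C : GaussCode} {r : ℕ} (hC : C.knot.HasPeriod (p ^ r))
    (hq : 3 ≤ p ^ r) {α : kˣ} {τ : (DualNumber k)ˣ}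
    (hτ : Units.map (TrivSqZeroExt.fstHom k k k : DualNumber k →+* k) τ = α)
    (hlt : ENat.card k < (colorings α C.word).encard)
    (hle : (colorings α C.word).encard ≤ ENat.card k ^ 2) :
    (colorings α C.word).encard ^ 2 ≤ (colorings τ C.word).encard := by
  obtain ⟨D, hD, hper⟩ := hC
  replace hD : D.code.knot = C.knot := hD
  rw [← GaussCode.encard_colorings_eq hD] at hlt hle ⊢
  rw [← GaussCode.encard_colorings_eq hD]
  -- A diagram without classical crossings has only constant colourings, which `hlt` excludes; for
  -- the empty code `ZMod 0` would not index the letters.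
  have hL : NeZero D.code.word.length := by
    refine ⟨fun h => ?_⟩
    rw [List.length_eq_zero_iff.1 h] at hlt
    exact absurd (encard_colorings_nil_le α) (not_le.2 hlt)
  obtain ⟨c, hc, hov, hpos, hpart⟩ := hper.exists_symmetry (by omega)
  have : Finite (DualNumber k) := inferInstanceAs (Finite (k × k))
  have hfin : ∀ {X : Type _} [CommRing X] [Finite X] (t : Xˣ), (colorings t D.code.word).encard =
      (Nat.card (LinearMap.ker (D.code.semiarcEquations t)) : ℕ∞) := by
    intro X _ _ t
    rw [GaussCode.encard_colorings_eq_semiarc, ← ENat.card_coe_set_eq]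
    exact ENat.card_eq_coe_natCard _
  rw [hfin, ENat.card_eq_coe_natCard] at hle
  rw [hfin, hfin]
  exact_mod_cast card_ker_sq_le_of_periodic hτ hq hc hov hpos hpart (by exact_mod_cast hle)

theorem mainTheorem11 (m n : ℕ) (hm : 2 ≤ m) (hn : 2 ≤ n) (hmn : m.Coprime n)
    (p r : ℕ) (hp : p.Prime) (hr : 1 ≤ r) (hper : (torusKnot m n hmn).HasPeriod (p ^ r)) :
    p ∣ m ∨ p ∣ n ∨ (p = 2 ∧ r = 1) := by
  by_contra! hcon
  obtain ⟨hpm, hpn, hp2⟩ := hcon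
  have hq : 3 ≤ p ^ r := by
    rcases hp.two_le.eq_or_lt with h | h
    · have h1 : r ≠ 1 := hp2 h.symm
      have h2 : p ^ 2 ≤ p ^ r := Nat.pow_le_pow_right hp.pos (by omega)
      rw [← h] at h2 ⊢
      omega
    · exact (show 3 ≤ p ^ 1 by rwa [pow_one]).trans (Nat.pow_le_pow_right hp.pos hr)
  have : Fact p.Prime := ⟨hp⟩
  have hN : ((m * n : ℕ) : ZMod p) ≠ 0 := by
    rw [Ne, ZMod.natCast_eq_zero_iff, hp.dvd_mul]
    tauto
  have : NeZero ((m * n : ℕ) : ZMod p) := ⟨hN⟩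
  have : NeZero (m * n) := ⟨by positivity⟩
  -- As `p ∤ m * n`, this finite field contains a primitive `m * n`-th root of unity.
  let k := CyclotomicField (m * n) (ZMod p)
  have : CharP k p := charP_of_injective_algebraMap (algebraMap (ZMod p) k).injective p
  have : Module.Finite (ZMod p) k := IsCyclotomicExtension.finite {m * n} (ZMod p) k
  have : Finite k := Module.finite_of_finite (ZMod p)
  have hη := IsCyclotomicExtension.zeta_spec (m * n) (ZMod p) k
  set η : k := IsCyclotomicExtension.zeta (m * n) (ZMod p) k
  have hη0 : η ≠ 0 := hη.ne_zero (NeZero.ne _)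
  have hNk : ((m * n : ℕ) : k) ≠ 0 := by
    rw [← map_natCast (algebraMap (ZMod p) k)]
    exact (map_ne_zero _).2 hN
  have h1 : (η ^ m) ^ n = 1 := by rw [← pow_mul, hη.pow_eq_one]
  have h2 : (η ^ n) ^ m = 1 := by rw [← pow_mul', hη.pow_eq_one]
  have h3 : η ^ m ≠ 1 := hη.pow_ne_one_of_pos_of_lt (by omega) (by nlinarith)
  have h4 : η ^ n ≠ 1 := hη.pow_ne_one_of_pos_of_lt (by omega) (by nlinarith)
  let α : kˣ := Units.mk0 (η ^ m * η ^ n) (mul_ne_zero (pow_ne_zero _ hη0) (pow_ne_zero _ hη0))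
  have hα : (α : k) ^ (m * n) = 1 := by
    simp only [α, Units.val_mk0, mul_pow]
    rw [pow_mul' (η ^ m), h1, pow_mul (η ^ n), h2, one_pow, one_pow, one_mul]
  obtain ⟨τ, hτ, hroot⟩ := exists_dual_unit α
  have hlt := card_lt_encard_colorings_torus (t := α) hm hn hmn rfl h1 h2 h3 h4
  have hle := encard_colorings_torus_le (t := α) hm hn hmn
  have hdual := encard_colorings_torus_dual_le hm hn hmn hτ (hroot _ hNk hα)
  have hsq := VirtualKnot.HasPeriod.encard_colorings_sq_le (C := torusCode m n hmn) hper hq hτ hlt hle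
  replace hsq := hsq.trans hdual
  change (colorings α (torusWord m n)).encard ^ 2 ≤ _ at hsq
  rw [ENat.card_eq_coe_natCard] at hlt hle hsq
  obtain ⟨a, ha⟩ := ENat.ne_top_iff_exists.1 (ne_top_of_le_ne_top (by simp) hle)
  rw [← ha] at hlt hsq
  norm_cast at hlt hsq
  -- With `a` colourings over `k`, the bounds `a ^ 2 ≤ |k| * a` and `|k| < a` are incompatible.
  nlinarith
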